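/- Let $1\le k<d$ be integers and let $f:\mathbb R^d\to\mathbb R$ be twice differentiable with $L$-Lipschitz gradient ($L\ge 0$), $\mu$-strongly convex ($\mu>0$), and $M$-strongly self-concordant for some $M\ge 0$, i.e. $\nabla^2 f(y)-\nabla^2 f(x)\preceq M\|y-x\|_z\nabla^2 f(w)$ for all $x,y,z,w\in\mathbb R^d$, where $\|v\|_z=(v^\top\nabla^2 f(z)v)^{1/2}$ and $\preceq$ is the Loewner order. Put $\lambda(x)=\big(\nabla f(x)^\top(\nabla^2 f(x))^{-1}\nabla f(x)\big)^{1/2}$. For $d\times d$ matrices $G,A,\mathbf L$, a $d\times k$ matrix $S$ and a $d\times k$ matrix $U$, put $$\mathrm{BlockBFGS}(G,A,S)=G-GS(S^\top GS)^{-1}S^\top G+AS(S^\top AS)^{-1}S^\top A,$$ $$\mathrm{UpdateL}(\mathbf L,A,U)=\mathbf L+\big(U(U^\top U)^{-1/2}-\mathbf LA\mathbf L^\top U\,W^{-1/2}\big)W^{-1/2}U^\top\mathbf L,\qquad W=U^\top\mathbf LA\mathbf L^\top U.$$ The faster randomized block BFGS method starts from $x_0\in\mathbb R^d$ and $G_0,\mathbf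 L_0\in\mathbb R^{d\times d}$ and, for $t=0,1,2,\dots$, computes $$x_{t+1}=x_t-G_t^{-1}\nabla f(x_t),\quad r_t=\|x_{t+1}-x_t\|_{x_t},\quad \tilde G_t=(1+Mr_t)G_t,\quad \tilde{\mathbf L}_t=\mathbf L_t/\sqrt{1+Mr_t},$$ $$G_{t+1}=\mathrm{BlockBFGS}(\tilde G_t,\nabla^2 f(x_{t+1}),\tilde{\mathbf L}_t^\top U_t),\qquad \mathbf L_{t+1}=\mathrm{UpdateL}(\tilde{\mathbf L}_t,\nabla^2 f(x_{t+1}),U_t),$$ where the entries of all the random matrices $U_0,U_1,\dots\in\mathbb R^{d\times k}$ are independent standard normal variables. Suppose that for some $\eta_0\ge 1$ $$M\lambda(x_0)\le\frac{\ln 2}{4}\cdot\frac{d-k}{\eta_0d^2},\qquad \nabla^2 f(x_0)\preceq G_0\preceq\eta_0\nabla^2 f(x_0),\qquad G_0^{-1}=\mathbf L_0^\top\mathbf L_0 .$$ Then, for every $t\ge 0$, the ratio $\lambda(x_{t+1})/\lambda(x_t)$ (read as $0$ when $\lambda(x_t)=0$; in that case $x_t$ is the minimizer of $f$) is integrable and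 $$\mathbb E\left[\frac{\lambda(x_{t+1})}{\lambda(x_t)}\right]\le 2d\eta_0\left(1-\frac kd\right)^t .$$ -/

import Mathlib

open MeasureTheory ProbabilityTheory
open scoped Matrix MatrixOrder NNReal

noncomputable section

namespace BlockBFGS

/-- The Hessian matrix of `f` at `x`: its `(i, j)` entry is the partial derivative in direction `j`
of the `i`-th coordinate of the gradient of `f`. -/
def hess {d : ℕ} (f : EuclideanSpace ℝ (Fin d) → ℝ) (x : EuclideanSpace ℝ (Fin d)) :
    Matrix (Fin d) (Fin d) ℝ :=
  Matrix.of fun i j => (fderiv ℝ (gradient f) x (EuclideanSpace.single j 1)) i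

/-- The weighted norm `‖v‖_A = (vᵀ A v) ^ (1/2)`. -/
def wnorm {d : ℕ} (A : Matrix (Fin d) (Fin d) ℝ) (v : EuclideanSpace ℝ (Fin d)) : ℝ :=
  √(v.ofLp ⬝ᵥ (A *ᵥ v.ofLp))

/-- `f` is `M`-strongly self-concordant. The order on matrices is the Loewner order:
`A ≤ B` means that `B - A` is symmetric positive semidefinite. -/
def StronglySelfConcordant {d : ℕ} (M : ℝ) (f : EuclideanSpace ℝ (Fin d) → ℝ) : Prop :=
  0 ≤ M ∧ ∀ x y z w : EuclideanSpace ℝ (Fin d),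
    hess f y - hess f x ≤ (M * wnorm (hess f z) (y - x)) • hess f w

/-- The local gradient norm `λ(x) = (∇f(x)ᵀ (∇²f(x))⁻¹ ∇f(x)) ^ (1/2)`. -/
def localGradNorm {d : ℕ} (f : EuclideanSpace ℝ (Fin d) → ℝ) (x : EuclideanSpace ℝ (Fin d)) : ℝ :=
  wnorm (hess f x)⁻¹ (gradient f x)

/-- The block BFGS update
`G - G U (Uᵀ G U)⁻¹ Uᵀ G + A U (Uᵀ A U)⁻¹ Uᵀ A`.
(It is meant for positive definite `A`, `G` and `U` of full column rank, when both inverses are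
genuine.) -/
def blockBFGS {d k : ℕ} (G A : Matrix (Fin d) (Fin d) ℝ) (U : Matrix (Fin d) (Fin k) ℝ) :
    Matrix (Fin d) (Fin d) ℝ :=
  G - G * U * (Uᵀ * G * U)⁻¹ * Uᵀ * G + A * U * (Uᵀ * A * U)⁻¹ * Uᵀ * A

/-- `S ^ (-1/2)` for a symmetric positive definite matrix `S`: the positive semidefinite square
root of `S⁻¹`. -/
def invSqrt {k : ℕ} (S : Matrix (Fin k) (Fin k) ℝ) : Matrix (Fin k) (Fin k) ℝ :=
  CFC.sqrt S⁻¹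

/-- The update of the factor `L` of `G⁻¹ = Lᵀ L`:
`L + (U (Uᵀ U)^(-1/2) - L A Lᵀ U W^(-1/2)) W^(-1/2) Uᵀ L` with `W = Uᵀ L A Lᵀ U`. -/
def updateL {d k : ℕ} (L A : Matrix (Fin d) (Fin d) ℝ) (U : Matrix (Fin d) (Fin k) ℝ) :
    Matrix (Fin d) (Fin d) ℝ :=
  L + (U * invSqrt (Uᵀ * U) - L * A * Lᵀ * U * invSqrt (Uᵀ * L * A * Lᵀ * U)) *
    invSqrt (Uᵀ * L * A * Lᵀ * U) * Uᵀ * L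

/-- The state of the algorithm: the iterate `x`, the Hessian estimator `G` and the factor `L`. -/
structure State (d : ℕ) where
  x : EuclideanSpace ℝ (Fin d)
  G : Matrix (Fin d) (Fin d) ℝ
  L : Matrix (Fin d) (Fin d) ℝ

/-- The quasi-Newton step `x - G⁻¹ ∇f(x)`. -/
def State.nextX {d : ℕ} (f : EuclideanSpace ℝ (Fin d) → ℝ) (s : State d) :
    EuclideanSpace ℝ (Fin d) :=
  s.x - WithLp.toLp 2 (s.G⁻¹ *ᵥ (gradient f s.x).ofLp)

/-- The correction factor `1 + M r`, where `r = ‖x₊ - x‖_x` is measured in the Hessian at `x`. -/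
def State.corr {d : ℕ} (f : EuclideanSpace ℝ (Fin d) → ℝ) (M : ℝ) (s : State d) : ℝ :=
  1 + M * wnorm (hess f s.x) (s.nextX f - s.x)

/-- One iteration of the faster randomized block BFGS method with direction matrix `U`. -/
def State.step {d k : ℕ} (f : EuclideanSpace ℝ (Fin d) → ℝ) (M : ℝ) (s : State d)
    (U : Matrix (Fin d) (Fin k) ℝ) : State d :=
  let x' := s.nextX f
  let G' := s.corr f M • s.G
  let L' := (√(s.corr f M))⁻¹ • s.L
  { x := x'
    G := blockBFGS G' (hess f x') (L'ᵀ * U)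
    L := updateL L' (hess f x') U }

/-- The state after `t` iterations of the faster randomized block BFGS method started at `s₀`,
with direction matrices `U 0, U 1, …`. -/
def run {d k : ℕ} (f : EuclideanSpace ℝ (Fin d) → ℝ) (M : ℝ) (s₀ : State d)
    (U : ℕ → Matrix (Fin d) (Fin k) ℝ) : ℕ → State d
  | 0 => s₀
  | t + 1 => (run f M s₀ U t).step f M (U t)

/-- The entries of the random `d × k` matrices `U 0, U 1, …` are all independent standard
normal random variables. -/
def IsIIDGaussian {d k : ℕ} {Ω : Type*} [MeasurableSpace Ω] (P : Measure Ω)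
    (U : ℕ → Ω → Matrix (Fin d) (Fin k) ℝ) : Prop :=
  (∀ t i j, HasLaw (fun ω => U t ω i j) (gaussianReal 0 1) P) ∧
    iIndepFun (fun (p : ℕ × Fin d × Fin k) ω => U p.1 ω p.2.1 p.2.2) P

end BlockBFGS

end

set_option linter.unusedSectionVars false

/-! ### Positive semidefinite real matrices and the Loewner order. -/

namespace Matrix

variable {m n : Type*} [Fintype m] [Fintype n]

/-! Write H for the Hessian at the current point, a = M λ, q = 1 - k/d, and measure the estimator by
σ = tr(H⁻¹ G) - d. As long as H ≤ G, σ is nonnegative and G ≤ (1 + σ) H.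

Deterministic part. If H ≤ G ≤ η H, one step multiplies λ by at most (1 + a/2)(1 - 1/η + a/2).
Self-concordance and the correction factor keep the estimator above the Hessian, while η grows by at
most (1 + a)² per iteration. These facts support each other: while η ≤ (9/8) η₀, a decays at the
rate ρ = 1 - 3/(4 η₀), so the growth of η has a bounded product (`invariant_run`). With η = 1 + σ
the same contraction bounds the ratio in the theorem by (1 + a/2)(σ + a/2), so it remains to control
the expectation of σ.

Random part. Since G⁻¹ = Lᵀ L, the sketch LᵀU turns the block removed from G into L⁻¹ Π L⁻ᵀ (for the
rescaled L), with Π the Euclidean projection onto the range of U. The update changes the trace by k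
- tr(B Π), where B depends only on the past. Row permutations and sign changes preserve the Gaussian
law, so E Π = (k/d) I, and E σ₊ = q E(tr B - d) with tr B ≤ (1 + a)² (σ + d).

The errors of order a are absorbed by the potential σ + 2 d a, whose expectation contracts by q (1 +
K b) if a ≤ b (`integral_potential_succ_le`). The bounds b form a geometric sequence, so the product
of the factors 1 + K b is bounded; the initial radius makes this product times 1 + ε/2 at most 2,
where ε bounds the initial a. The initial potential is at most d η₀. -/

theorem dotProduct_mulVec_mono {A B : Matrix n n ℝ} (h : A ≤ B) (v : n → ℝ) :
    v ⬝ᵥ A *ᵥ v ≤ v ⬝ᵥ B *ᵥ v := by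
  have := (le_iff.1 h).dotProduct_mulVec_nonneg v
  simp only [star_trivial, sub_mulVec, dotProduct_sub] at this
  linarith

theorem le_of_dotProduct_mulVec_le {A B : Matrix n n ℝ} (hA : Aᵀ = A) (hB : Bᵀ = B)
    (h : ∀ v : n → ℝ, v ⬝ᵥ A *ᵥ v ≤ v ⬝ᵥ B *ᵥ v) : A ≤ B := by
  refine le_iff.2 (PosSemidef.of_dotProduct_mulVec_nonneg ?_ fun v => ?_)
  · simp [IsHermitian, conjTranspose_eq_transpose_of_trivial, hA, hB]
  · simpa [sub_mulVec, dotProduct_sub] using h v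

theorem PosSemidef.transpose_eq {A : Matrix n n ℝ} (hA : A.PosSemidef) : Aᵀ = A := by
  simpa [IsHermitian, conjTranspose_eq_transpose_of_trivial] using hA.isHermitian

theorem PosDef.transpose_eq {A : Matrix n n ℝ} (hA : A.PosDef) : Aᵀ = A :=
  hA.posSemidef.transpose_eq

theorem PosSemidef.exists_eq_transpose_mul {A : Matrix n n ℝ} (hA : A.PosSemidef) :
    ∃ B : Matrix n n ℝ, A = Bᵀ * B := by
  classical
  obtain ⟨B, hB⟩ := CStarAlgebra.nonneg_iff_eq_star_mul_self.mp hA.nonneg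
  exact ⟨B, by simpa [star_eq_conjTranspose, conjTranspose_eq_transpose_of_trivial] using hB⟩

theorem dotProduct_transpose_mul_mulVec (B : Matrix m n ℝ) (u v : n → ℝ) :
    u ⬝ᵥ (Bᵀ * B) *ᵥ v = (B *ᵥ u) ⬝ᵥ (B *ᵥ v) := by
  rw [← mulVec_mulVec, dotProduct_mulVec, vecMul_transpose]

theorem dotProduct_mulVec_symm {A : Matrix n n ℝ} (hA : Aᵀ = A) (u v : n → ℝ) :
    u ⬝ᵥ A *ᵥ v = v ⬝ᵥ A *ᵥ u := by
  rw [dotProduct_mulVec, dotProduct_comm]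
  nth_rw 1 [← hA]
  rw [vecMul_transpose]

/-- Cauchy–Schwarz for the bilinear form of a positive semidefinite matrix. -/
theorem PosSemidef.sq_dotProduct_mulVec_le {A : Matrix n n ℝ} (hA : A.PosSemidef) (u v : n → ℝ) :
    (u ⬝ᵥ A *ᵥ v) ^ 2 ≤ (u ⬝ᵥ A *ᵥ u) * (v ⬝ᵥ A *ᵥ v) := by
  obtain ⟨B, rfl⟩ := hA.exists_eq_transpose_mul
  rw [dotProduct_transpose_mul_mulVec, dotProduct_transpose_mul_mulVec,
    dotProduct_transpose_mul_mulVec]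
  simpa [sq, dotProduct] using Finset.sum_mul_sq_le_sq_mul_sq Finset.univ (B *ᵥ u) (B *ᵥ v)

theorem conj_mono {A B : Matrix n n ℝ} (h : A ≤ B) (R : Matrix n m ℝ) :
    Rᵀ * A * R ≤ Rᵀ * B * R := by
  have := (le_iff.1 h).conjTranspose_mul_mul_same R
  rw [le_iff]
  simpa [conjTranspose_eq_transpose_of_trivial, Matrix.mul_sub, Matrix.sub_mul] using this

theorem PosSemidef.trace_mul_nonneg {A B : Matrix n n ℝ} (hA : A.PosSemidef) (hB : B.PosSemidef) :
    0 ≤ (A * B).trace := by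
  obtain ⟨C, rfl⟩ := hA.exists_eq_transpose_mul
  rw [Matrix.mul_assoc, trace_mul_comm]
  simpa [conjTranspose_eq_transpose_of_trivial] using (hB.mul_mul_conjTranspose_same C).trace_nonneg

theorem trace_mul_le_trace_mul {A B C : Matrix n n ℝ} (h : A ≤ B) (hC : C.PosSemidef) :
    (A * C).trace ≤ (B * C).trace := by
  have := (le_iff.1 h).trace_mul_nonneg hC
  rw [Matrix.sub_mul, trace_sub] at this
  linarith

theorem PosDef.of_le {A B : Matrix n n ℝ} (hA : A.PosDef) (h : A ≤ B) : B.PosDef := by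
  simpa using hA.add_posSemidef (le_iff.1 h)

variable [DecidableEq n] [DecidableEq m]

theorem PosDef.det_isUnit {A : Matrix n n ℝ} (hA : A.PosDef) : IsUnit A.det :=
  (isUnit_iff_isUnit_det A).1 hA.isUnit

theorem PosDef.mul_inv {A : Matrix n n ℝ} (hA : A.PosDef) : A * A⁻¹ = 1 :=
  mul_nonsing_inv A hA.det_isUnit

theorem PosDef.inv_mul {A : Matrix n n ℝ} (hA : A.PosDef) : A⁻¹ * A = 1 :=
  nonsing_inv_mul A hA.det_isUnit

/-- For u = B⁻¹ v, expand the A-form at A⁻¹ v - u, which is nonnegative, and use uᵀAu ≤ uᵀBu = uᵀv.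
-/
theorem PosDef.inv_antitone {A B : Matrix n n ℝ} (hA : A.PosDef) (h : A ≤ B) : B⁻¹ ≤ A⁻¹ := by
  have hB := hA.of_le h
  refine le_of_dotProduct_mulVec_le hB.inv.transpose_eq hA.inv.transpose_eq fun v => ?_
  set u := B⁻¹ *ᵥ v with hu
  have hBu : B *ᵥ u = v := by rw [hu, mulVec_mulVec, hB.mul_inv, one_mulVec]
  have hAv : A *ᵥ (A⁻¹ *ᵥ v) = v := by rw [mulVec_mulVec, hA.mul_inv, one_mulVec]
  have h1 := hA.posSemidef.dotProduct_mulVec_nonneg (A⁻¹ *ᵥ v - u)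
  have h2 := dotProduct_mulVec_mono h u
  rw [hBu] at h2
  simp only [star_trivial, mulVec_sub, dotProduct_sub, sub_dotProduct, hAv] at h1
  rw [dotProduct_mulVec_symm hA.transpose_eq (A⁻¹ *ᵥ v) u, hAv] at h1
  rw [dotProduct_comm v u, dotProduct_comm v]
  linarith

/-- With X = YᵀY, each (Yᵢ · v)² is at most (Yᵢᵀ A⁻¹ Yᵢ)(vᵀ A v) by Cauchy–Schwarz for A⁻¹, and the
first factors sum to the trace. Applied to G - H, this turns the trace error into a Loewner bound.
-/
theorem PosSemidef.le_trace_inv_mul_smul {A X : Matrix n n ℝ} (hX : X.PosSemidef) (hA : A.PosDef) :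
    X ≤ (A⁻¹ * X).trace • A := by
  refine le_of_dotProduct_mulVec_le hX.transpose_eq (by rw [transpose_smul, hA.transpose_eq])
    fun v => ?_
  obtain ⟨Y, rfl⟩ := hX.exists_eq_transpose_mul
  have hAv : A⁻¹ *ᵥ (A *ᵥ v) = v := by rw [mulVec_mulVec, hA.inv_mul, one_mulVec]
  rw [dotProduct_transpose_mul_mulVec, ← Matrix.mul_assoc, trace_mul_comm, smul_mulVec,
    dotProduct_smul, smul_eq_mul, trace, Finset.sum_mul, dotProduct]
  refine Finset.sum_le_sum fun i _ => ?_
  have h := hA.inv.posSemidef.sq_dotProduct_mulVec_le (Y i) (A *ᵥ v)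
  rw [hAv, dotProduct_comm (A *ᵥ v) v] at h
  have h1 : diag (Y * (A⁻¹ * Yᵀ)) i = Y i ⬝ᵥ A⁻¹ *ᵥ Y i := by
    simp [diag_apply, mul_apply, dotProduct, mulVec]
  rw [h1, ← sq]
  exact h

/-- If `0 ≤ X ≤ c A⁻¹` then `X A X ≤ c² A⁻¹`. -/
theorem PosSemidef.dotProduct_mul_mul_mulVec_le {A X : Matrix n n ℝ} {c : ℝ} (hX : X.PosSemidef)
    (hA : A.PosDef) (hXA : X ≤ c • A⁻¹) (v : n → ℝ) :
    (X *ᵥ v) ⬝ᵥ A *ᵥ (X *ᵥ v) ≤ c ^ 2 * (v ⬝ᵥ A⁻¹ *ᵥ v) := by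
  set w := A *ᵥ (X *ᵥ v) with hw
  set p := (X *ᵥ v) ⬝ᵥ w with hp
  -- `p` is both the X-pairing of `v` and `w` and the A⁻¹-form of `w`. Cauchy–Schwarz for X thus
  -- gives p² ≤ c² (vᵀ A⁻¹ v) p, and one factor `p` cancels.
  have h1 : v ⬝ᵥ X *ᵥ w = p := by
    rw [dotProduct_mulVec_symm hX.transpose_eq, dotProduct_comm]
  have h2 := hX.sq_dotProduct_mulVec_le v w
  have h3 := dotProduct_mulVec_mono hXA v
  have h4 := dotProduct_mulVec_mono hXA w
  have h5 : w ⬝ᵥ A⁻¹ *ᵥ w = p := by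
    rw [hp, hw, mulVec_mulVec (M := A⁻¹), hA.inv_mul, one_mulVec, dotProduct_comm]
  simp only [smul_mulVec, dotProduct_smul, smul_eq_mul, h5] at h3 h4
  rw [h1] at h2
  have h6 : 0 ≤ p := hA.posSemidef.dotProduct_mulVec_nonneg (X *ᵥ v)
  have h7 : 0 ≤ v ⬝ᵥ X *ᵥ v := hX.dotProduct_mulVec_nonneg v
  have h8 : 0 ≤ w ⬝ᵥ X *ᵥ w := hX.dotProduct_mulVec_nonneg w
  have h9 : p ^ 2 ≤ (c * (v ⬝ᵥ A⁻¹ *ᵥ v)) * (c * p) :=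
    h2.trans (mul_le_mul h3 h4 h8 (h7.trans h3))
  rcases h6.eq_or_lt with h0 | h0
  · rw [← h0]
    exact mul_nonneg (sq_nonneg c) (hA.inv.posSemidef.dotProduct_mulVec_nonneg v)
  · nlinarith

theorem PosDef.isUnit_det_conj_iff {A : Matrix n n ℝ} (hA : A.PosDef) (U : Matrix n m ℝ) :
    IsUnit (Uᵀ * A * U).det ↔ (Uᵀ * A * U).PosDef := by
  have h : (Uᵀ * A * U).PosSemidef := by
    simpa [conjTranspose_eq_transpose_of_trivial] using hA.posSemidef.conjTranspose_mul_mul_same U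
  rw [h.posDef_iff_isUnit, isUnit_iff_isUnit_det]

/-- Definiteness of UᵀBU forces `U` to be injective, and injectivity does not depend on the matrix
in the middle. -/
theorem PosDef.conj_posDef_of_conj_posDef {A B : Matrix n n ℝ} (hA : A.PosDef) {U : Matrix n m ℝ}
    (hU : (Uᵀ * B * U).PosDef) : (Uᵀ * A * U).PosDef := by
  have := hA.conjTranspose_mul_mul_same (B := U) ?_
  · simpa [conjTranspose_eq_transpose_of_trivial] using this
  · refine (injective_iff_map_eq_zero (U.mulVecLin)).2 fun v hv => ?_
    by_contra hne
    have h1 := hU.dotProduct_mulVec_pos hne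
    have h2 : U *ᵥ v = 0 := hv
    rw [← mulVec_mulVec, h2] at h1
    simp at h1

end Matrix

/-! ### Algebra of the block BFGS update and of its factored form. -/

namespace BlockBFGS

open Matrix

variable {d k : ℕ}

/-- The part `G - G S (Sᵀ G S)⁻¹ Sᵀ G` of the block BFGS update. -/
noncomputable def residual (G : Matrix (Fin d) (Fin d) ℝ) (S : Matrix (Fin d) (Fin k) ℝ) :
    Matrix (Fin d) (Fin d) ℝ :=
  G - G * S * (Sᵀ * G * S)⁻¹ * Sᵀ * G

theorem residual_mul_self {G : Matrix (Fin d) (Fin d) ℝ} {S : Matrix (Fin d) (Fin k) ℝ}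
    (h : (Sᵀ * G * S).PosDef) : residual G S * S = 0 := by
  have h1 : (Sᵀ * G * S)⁻¹ * (Sᵀ * G * S) = 1 := h.inv_mul
  have : G * S * (Sᵀ * G * S)⁻¹ * Sᵀ * G * S = G * S * ((Sᵀ * G * S)⁻¹ * (Sᵀ * G * S)) := by
    simp only [Matrix.mul_assoc]
  rw [residual, Matrix.sub_mul, this, h1, Matrix.mul_one, sub_self]

theorem transpose_mul_residual {G : Matrix (Fin d) (Fin d) ℝ} {S : Matrix (Fin d) (Fin k) ℝ}
    (h : (Sᵀ * G * S).PosDef) : Sᵀ * residual G S = 0 := by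
  have h1 : (Sᵀ * G * S) * (Sᵀ * G * S)⁻¹ = 1 := h.mul_inv
  have : Sᵀ * (G * S * (Sᵀ * G * S)⁻¹ * Sᵀ * G) = (Sᵀ * G * S) * (Sᵀ * G * S)⁻¹ * (Sᵀ * G) := by
    simp only [Matrix.mul_assoc]
  rw [residual, Matrix.mul_sub, this, h1, Matrix.one_mul, sub_self]

/-- The projection along the range of `S`, orthogonal with respect to `G`. -/
noncomputable def coproj (G : Matrix (Fin d) (Fin d) ℝ) (S : Matrix (Fin d) (Fin k) ℝ) :
    Matrix (Fin d) (Fin d) ℝ :=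
  1 - S * (Sᵀ * G * S)⁻¹ * Sᵀ * G

theorem mul_coproj (G : Matrix (Fin d) (Fin d) ℝ) (S : Matrix (Fin d) (Fin k) ℝ) :
    G * coproj G S = residual G S := by
  simp only [coproj, residual, Matrix.mul_sub, Matrix.mul_one, Matrix.mul_assoc]

theorem coproj_transpose {G : Matrix (Fin d) (Fin d) ℝ} (hG : G.PosDef)
    {S : Matrix (Fin d) (Fin k) ℝ} (h : (Sᵀ * G * S).PosDef) :
    (coproj G S)ᵀ = 1 - G * S * (Sᵀ * G * S)⁻¹ * Sᵀ := by
  rw [coproj, transpose_sub, transpose_one, transpose_mul, transpose_mul, transpose_mul,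
    transpose_transpose, hG.transpose_eq, h.inv.transpose_eq]
  simp only [Matrix.mul_assoc]

/-- `coproj G S` differs from the identity by a matrix with range in that of `S`, which `residual A
S` annihilates on both sides, even though the projection belongs to another matrix. -/
theorem coproj_transpose_mul_mul {A G : Matrix (Fin d) (Fin d) ℝ} (hG : G.PosDef)
    {S : Matrix (Fin d) (Fin k) ℝ} (hA : (Sᵀ * A * S).PosDef) (h : (Sᵀ * G * S).PosDef) :
    (coproj G S)ᵀ * residual A S * coproj G S = residual A S := by
  have h1 : (coproj G S)ᵀ * residual A S = residual A S := by
    rw [coproj_transpose hG h, Matrix.sub_mul, Matrix.one_mul, Matrix.mul_assoc _ Sᵀ,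
      transpose_mul_residual hA, Matrix.mul_zero, sub_zero]
  rw [h1, coproj, Matrix.mul_sub, Matrix.mul_one]
  have : residual A S * (S * (Sᵀ * G * S)⁻¹ * Sᵀ * G) =
      residual A S * S * ((Sᵀ * G * S)⁻¹ * Sᵀ * G) := by simp only [Matrix.mul_assoc]
  rw [this, residual_mul_self hA, Matrix.zero_mul, sub_zero]

theorem residual_eq_conj {G : Matrix (Fin d) (Fin d) ℝ} (hG : G.PosDef)
    {S : Matrix (Fin d) (Fin k) ℝ} (h : (Sᵀ * G * S).PosDef) :
    residual G S = (coproj G S)ᵀ * G * coproj G S := by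
  rw [Matrix.mul_assoc, mul_coproj, coproj_transpose hG h, Matrix.sub_mul, Matrix.one_mul,
    Matrix.mul_assoc _ Sᵀ, transpose_mul_residual h, Matrix.mul_zero, sub_zero]

theorem posSemidef_mul_inv_mul {A : Matrix (Fin d) (Fin d) ℝ} (hA : A.PosDef)
    {S : Matrix (Fin d) (Fin k) ℝ} (h : (Sᵀ * A * S).PosDef) :
    (A * S * (Sᵀ * A * S)⁻¹ * Sᵀ * A).PosSemidef := by
  have := h.inv.posSemidef.conjTranspose_mul_mul_same (Sᵀ * A)
  simpa [conjTranspose_eq_transpose_of_trivial, transpose_mul, hA.transpose_eq,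
    Matrix.mul_assoc] using this

theorem residual_le {A : Matrix (Fin d) (Fin d) ℝ} (hA : A.PosDef)
    {S : Matrix (Fin d) (Fin k) ℝ} (h : (Sᵀ * A * S).PosDef) : residual A S ≤ A := by
  rw [le_iff, residual, sub_sub_cancel]
  exact posSemidef_mul_inv_mul hA h

/-- Conjugation by the one projection `coproj G S` yields `residual G S` from `G` and fixes
`residual A S`, so the claim reduces to residual A S ≤ A ≤ G. -/
theorem residual_mono {A G : Matrix (Fin d) (Fin d) ℝ} (hA : A.PosDef) (hG : G.PosDef)
    (hAG : A ≤ G) {S : Matrix (Fin d) (Fin k) ℝ} (hAS : (Sᵀ * A * S).PosDef)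
    (hGS : (Sᵀ * G * S).PosDef) : residual A S ≤ residual G S := by
  rw [← coproj_transpose_mul_mul hG hAS hGS, residual_eq_conj hG hGS]
  exact conj_mono ((residual_le hA hAS).trans hAG) _

theorem residual_smul {η : ℝ} (hη : 0 < η) (A : Matrix (Fin d) (Fin d) ℝ)
    {S : Matrix (Fin d) (Fin k) ℝ} (hAS : (Sᵀ * A * S).PosDef) :
    residual (η • A) S = η • residual A S := by
  have h : (Sᵀ * (η • A) * S)⁻¹ = η⁻¹ • (Sᵀ * A * S)⁻¹ := by
    rw [Matrix.mul_smul, Matrix.smul_mul]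
    let _ := invertibleOfNonzero hη.ne'
    rw [inv_smul (k := η) _ hAS.det_isUnit, invOf_eq_inv]
  rw [residual, residual, h]
  simp only [Matrix.mul_smul, Matrix.smul_mul, smul_sub, smul_smul]
  congr 2
  field_simp

theorem blockBFGS_eq (G A : Matrix (Fin d) (Fin d) ℝ) (S : Matrix (Fin d) (Fin k) ℝ) :
    blockBFGS G A S = residual G S + A * S * (Sᵀ * A * S)⁻¹ * Sᵀ * A := rfl

/-- A singular block has inverse 0 by convention, so a rank-deficient direction matrix changes
nothing. Hence the Loewner bounds below hold for every outcome, not only almost surely. -/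
theorem blockBFGS_eq_self {G A : Matrix (Fin d) (Fin d) ℝ} (hG : G.PosDef) (hA : A.PosDef)
    {S : Matrix (Fin d) (Fin k) ℝ} (h : ¬ (Sᵀ * A * S).PosDef) : blockBFGS G A S = G := by
  have h' : ¬ (Sᵀ * G * S).PosDef := fun hg => h (hA.conj_posDef_of_conj_posDef hg)
  rw [← hA.isUnit_det_conj_iff] at h
  rw [← hG.isUnit_det_conj_iff] at h'
  simp [blockBFGS, nonsing_inv_apply_not_isUnit _ h, nonsing_inv_apply_not_isUnit _ h']

theorem le_blockBFGS {G A : Matrix (Fin d) (Fin d) ℝ} (hA : A.PosDef) (hAG : A ≤ G)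
    (S : Matrix (Fin d) (Fin k) ℝ) : A ≤ blockBFGS G A S := by
  have hG := hA.of_le hAG
  by_cases h : (Sᵀ * A * S).PosDef
  · have h' := hG.conj_posDef_of_conj_posDef h
    have := residual_mono hA hG hAG h h'
    rw [blockBFGS_eq, ← sub_le_iff_le_add]
    exact this
  · rwa [blockBFGS_eq_self hG hA h]

/-- Split η A into η times its residual and η times the added term: monotonicity of the residual
handles the first part, η ≥ 1 the second. -/
theorem blockBFGS_le {G A : Matrix (Fin d) (Fin d) ℝ} (hA : A.PosDef) (hG : G.PosDef) {η : ℝ}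
    (hη : 1 ≤ η) (hGA : G ≤ η • A) (S : Matrix (Fin d) (Fin k) ℝ) :
    blockBFGS G A S ≤ η • A := by
  by_cases h : (Sᵀ * A * S).PosDef
  · have hη0 : 0 < η := by linarith
    have hGS := hG.conj_posDef_of_conj_posDef h
    have hηA : (η • A).PosDef := hG.of_le hGA
    have h1 := residual_mono hG hηA hGA hGS (hηA.conj_posDef_of_conj_posDef h)
    rw [residual_smul hη0 A h] at h1
    have h3 : A * S * (Sᵀ * A * S)⁻¹ * Sᵀ * A ≤ η • (A * S * (Sᵀ * A * S)⁻¹ * Sᵀ * A) := by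
      rw [le_iff]
      have := (posSemidef_mul_inv_mul hA h).smul (sub_nonneg.2 hη)
      rwa [sub_smul, one_smul] at this
    have h4 : η • A = η • residual A S + η • (A * S * (Sᵀ * A * S)⁻¹ * Sᵀ * A) := by
      rw [← smul_add, residual, sub_add_cancel]
    rw [blockBFGS_eq, h4]
    exact add_le_add h1 h3
  · rwa [blockBFGS_eq_self hG hA h]

/-- The block BFGS formula for the inverse of the updated matrix. -/
theorem blockBFGS_mul_inverse {G A : Matrix (Fin d) (Fin d) ℝ} (hG : G.PosDef) (hA : A.PosDef)
    {S : Matrix (Fin d) (Fin k) ℝ} (h : (Sᵀ * A * S).PosDef) :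
    blockBFGS G A S *
      (S * (Sᵀ * A * S)⁻¹ * Sᵀ + coproj A S * G⁻¹ * (coproj A S)ᵀ) = 1 := by
  have hGS := hG.conj_posDef_of_conj_posDef h
  -- The secant equation: the updated matrix acts as `A` on the range of `S`.
  have h1 : blockBFGS G A S * S = A * S := by
    have : A * S * (Sᵀ * A * S)⁻¹ * Sᵀ * A * S = A * S * ((Sᵀ * A * S)⁻¹ * (Sᵀ * A * S)) := by
      simp only [Matrix.mul_assoc]
    rw [blockBFGS_eq, Matrix.add_mul, residual_mul_self hGS, this, h.inv_mul, Matrix.mul_one,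
      zero_add]
  have h2 : blockBFGS G A S * coproj A S = residual G S := by
    rw [coproj, Matrix.mul_sub, Matrix.mul_one]
    have : blockBFGS G A S * (S * (Sᵀ * A * S)⁻¹ * Sᵀ * A) =
        blockBFGS G A S * S * ((Sᵀ * A * S)⁻¹ * Sᵀ * A) := by simp only [Matrix.mul_assoc]
    rw [this, h1, blockBFGS_eq]
    simp only [Matrix.mul_assoc, add_sub_cancel_right]
  have h3 : residual G S * G⁻¹ = (coproj G S)ᵀ := by
    rw [coproj_transpose hG hGS, residual, Matrix.sub_mul, hG.mul_inv, Matrix.mul_assoc _ G,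
      hG.mul_inv, Matrix.mul_one]
  have h4 : Sᵀ * (coproj A S)ᵀ = 0 := by
    rw [← transpose_mul, coproj, Matrix.sub_mul, Matrix.one_mul]
    have : S * (Sᵀ * A * S)⁻¹ * Sᵀ * A * S = S * ((Sᵀ * A * S)⁻¹ * (Sᵀ * A * S)) := by
      simp only [Matrix.mul_assoc]
    rw [this, h.inv_mul, Matrix.mul_one, sub_self, transpose_zero]
  have h5 : (coproj G S)ᵀ * (coproj A S)ᵀ = (coproj A S)ᵀ := by
    rw [coproj_transpose hG hGS, Matrix.sub_mul, Matrix.one_mul, Matrix.mul_assoc _ Sᵀ, h4,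
      Matrix.mul_zero, sub_zero]
  rw [Matrix.mul_add, ← Matrix.mul_assoc, ← Matrix.mul_assoc, ← Matrix.mul_assoc,
    ← Matrix.mul_assoc, h1, h2, h3, h5, coproj_transpose hA h]
  exact add_sub_cancel _ _

theorem invSqrt_transpose (S : Matrix (Fin k) (Fin k) ℝ) : (invSqrt S)ᵀ = invSqrt S :=
  (CFC.sqrt_nonneg S⁻¹).posSemidef.transpose_eq

theorem invSqrt_mul_self {S : Matrix (Fin k) (Fin k) ℝ} (hS : S.PosDef) :
    invSqrt S * invSqrt S = S⁻¹ :=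
  CFC.sqrt_mul_sqrt_self S⁻¹ hS.inv.posSemidef.nonneg

theorem invSqrt_mul_mul {S : Matrix (Fin k) (Fin k) ℝ} (hS : S.PosDef) :
    invSqrt S * S * invSqrt S = 1 := by
  have h : invSqrt S * (invSqrt S * S) = 1 := by
    rw [← Matrix.mul_assoc, invSqrt_mul_self hS, hS.inv_mul]
  exact mul_eq_one_comm.1 h

theorem invSqrt_of_not_isUnit {S : Matrix (Fin k) (Fin k) ℝ} (hS : ¬ IsUnit S.det) :
    invSqrt S = 0 := by
  rw [invSqrt, nonsing_inv_apply_not_isUnit _ hS, CFC.sqrt_zero]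

theorem mul_mul_transpose_eq_one {G L : Matrix (Fin d) (Fin d) ℝ} (hG : G.PosDef)
    (hL : G⁻¹ = Lᵀ * L) : L * G * Lᵀ = 1 := by
  have h : Lᵀ * (L * G) = 1 := by rw [← Matrix.mul_assoc, ← hL, hG.inv_mul]
  exact mul_eq_one_comm.1 h

/-- With P = coproj A S, the new factor is L Pᵀ + U V T Sᵀ, where U V has orthonormal columns and T²
= (SᵀAS)⁻¹. In its Gram matrix the cross terms vanish because P S = 0, and the diagonal terms are
the two summands of the inverse update formula. In the rank-deficient case `invSqrt` is 0 and the
factor, like the estimator, is unchanged. -/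
theorem inv_blockBFGS_eq {G A L : Matrix (Fin d) (Fin d) ℝ} (hG : G.PosDef) (hA : A.PosDef)
    (hL : G⁻¹ = Lᵀ * L) (U : Matrix (Fin d) (Fin k) ℝ) :
    (blockBFGS G A (Lᵀ * U))⁻¹ = (updateL L A U)ᵀ * updateL L A U := by
  set S := Lᵀ * U with hS
  have hST : Sᵀ = Uᵀ * L := by rw [hS, transpose_mul, transpose_transpose]
  have hW : Uᵀ * L * A * Lᵀ * U = Sᵀ * A * S := by rw [hST, hS]; simp only [Matrix.mul_assoc]
  have hN : Uᵀ * U = Sᵀ * G * S := by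
    have : Sᵀ * G * S = Uᵀ * (L * G * Lᵀ) * U := by rw [hST, hS]; simp only [Matrix.mul_assoc]
    rw [this, mul_mul_transpose_eq_one hG hL, Matrix.mul_one]
  by_cases h : (Sᵀ * A * S).PosDef
  · have hGS := hG.conj_posDef_of_conj_posDef h
    refine inv_eq_right_inv ?_
    rw [← blockBFGS_mul_inverse hG hA h]
    congr 1
    set T := invSqrt (Sᵀ * A * S) with hT
    set V := invSqrt (Sᵀ * G * S) with hV
    have hTT : T * T = (Sᵀ * A * S)⁻¹ := invSqrt_mul_self h
    have hVV : V * (Uᵀ * U) * V = 1 := by rw [hN]; exact invSqrt_mul_mul hGS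
    have hup : updateL L A U = L * (coproj A S)ᵀ + U * V * T * Sᵀ := by
      rw [coproj_transpose hA h, ← hTT, updateL, hW, hN, ← hT, ← hV, Matrix.mul_sub, Matrix.mul_one,
        Matrix.sub_mul, Matrix.sub_mul, Matrix.sub_mul, hST, hS]
      simp only [Matrix.mul_assoc]
      abel
    have hcs : coproj A S * S = 0 := by
      have : S * (Sᵀ * A * S)⁻¹ * Sᵀ * A * S = S * ((Sᵀ * A * S)⁻¹ * (Sᵀ * A * S)) := by
        simp only [Matrix.mul_assoc]
      rw [coproj, Matrix.sub_mul, Matrix.one_mul, this, h.inv_mul, Matrix.mul_one, sub_self]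
    have hcs' : Sᵀ * (coproj A S)ᵀ = 0 := by rw [← transpose_mul, hcs, transpose_zero]
    have hVt : Vᵀ = V := invSqrt_transpose _
    have hTt : Tᵀ = T := invSqrt_transpose _
    have hupt : (updateL L A U)ᵀ = coproj A S * Lᵀ + S * T * V * Uᵀ := by
      rw [hup]
      simp only [transpose_add, transpose_mul, transpose_transpose, hVt, hTt, Matrix.mul_assoc]
    have e1 : coproj A S * Lᵀ * (L * (coproj A S)ᵀ) = coproj A S * G⁻¹ * (coproj A S)ᵀ := by
      rw [hL]; simp only [Matrix.mul_assoc]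
    have e2 : coproj A S * Lᵀ * (U * V * T * Sᵀ) = 0 := by
      have : coproj A S * Lᵀ * (U * V * T * Sᵀ) = coproj A S * S * (V * T * Sᵀ) := by
        rw [hS]; simp only [Matrix.mul_assoc]
      rw [this, hcs, Matrix.zero_mul]
    have e3 : S * T * V * Uᵀ * (L * (coproj A S)ᵀ) = 0 := by
      have : S * T * V * Uᵀ * (L * (coproj A S)ᵀ) = S * T * V * (Sᵀ * (coproj A S)ᵀ) := by
        rw [hST]; simp only [Matrix.mul_assoc]
      rw [this, hcs', Matrix.mul_zero]
    have e4 : S * T * V * Uᵀ * (U * V * T * Sᵀ) = S * (Sᵀ * A * S)⁻¹ * Sᵀ := by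
      have : S * T * V * Uᵀ * (U * V * T * Sᵀ) = S * (T * (V * (Uᵀ * U) * V) * T) * Sᵀ := by
        simp only [Matrix.mul_assoc]
      rw [this, hVV, Matrix.mul_one, hTT]
    rw [hupt, hup, Matrix.add_mul, Matrix.mul_add, Matrix.mul_add, e1, e2, e3, e4, add_zero,
      zero_add, add_comm]
  · rw [blockBFGS_eq_self hG hA h, hL]
    rw [← hA.isUnit_det_conj_iff] at h
    have : updateL L A U = L := by simp [updateL, hW, invSqrt_of_not_isUnit h]
    rw [this]

/-- The effect of a block BFGS update on `tr (A⁻¹ G)`. -/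
theorem trace_inv_mul_blockBFGS {G A L : Matrix (Fin d) (Fin d) ℝ} (hG : G.PosDef) (hA : A.PosDef)
    (hL : G⁻¹ = Lᵀ * L) {U : Matrix (Fin d) (Fin k) ℝ} (hU : IsUnit (Uᵀ * U).det) :
    (A⁻¹ * blockBFGS G A (Lᵀ * U)).trace =
      (A⁻¹ * G).trace + k - ((L⁻¹)ᵀ * A⁻¹ * L⁻¹ * (U * (Uᵀ * U)⁻¹ * Uᵀ)).trace := by
  set S := Lᵀ * U with hS
  have hST : Sᵀ = Uᵀ * L := by rw [hS, transpose_mul, transpose_transpose]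
  have hN : Sᵀ * G * S = Uᵀ * U := by
    have : Sᵀ * G * S = Uᵀ * (L * G * Lᵀ) * U := by rw [hST, hS]; simp only [Matrix.mul_assoc]
    rw [this, mul_mul_transpose_eq_one hG hL, Matrix.mul_one]
  have hGS : (Sᵀ * G * S).PosDef := by rwa [← hG.isUnit_det_conj_iff, hN]
  have hAS := hA.conj_posDef_of_conj_posDef hGS
  have hLG : L * G = (L⁻¹)ᵀ := by
    have h1 := mul_mul_transpose_eq_one hG hL
    rw [transpose_nonsing_inv]
    exact (inv_eq_left_inv h1).symm
  have hGL : G * Lᵀ = L⁻¹ := by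
    have h1 := mul_mul_transpose_eq_one hG hL
    rw [Matrix.mul_assoc] at h1
    exact (inv_eq_right_inv h1).symm
  have hGS' : G * S = L⁻¹ * U := by rw [hS, ← Matrix.mul_assoc, hGL]
  have hSG : Sᵀ * G = Uᵀ * (L⁻¹)ᵀ := by rw [hST, Matrix.mul_assoc, hLG]
  -- The reason for the sketch LᵀU: the removed block becomes L⁻¹ Π L⁻ᵀ, with Π the Euclidean
  -- projection onto the range of `U`.
  have t1 : (A⁻¹ * (G * S * (Sᵀ * G * S)⁻¹ * Sᵀ * G)).trace =
      ((L⁻¹)ᵀ * A⁻¹ * L⁻¹ * (U * (Uᵀ * U)⁻¹ * Uᵀ)).trace := by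
    have : A⁻¹ * (G * S * (Sᵀ * G * S)⁻¹ * Sᵀ * G) =
        (A⁻¹ * L⁻¹ * (U * (Uᵀ * U)⁻¹ * Uᵀ)) * (L⁻¹)ᵀ := by
      rw [hN, Matrix.mul_assoc _ Sᵀ G, hSG, hGS']; simp only [Matrix.mul_assoc]
    rw [this, trace_mul_comm]
    simp only [Matrix.mul_assoc]
  have t2 : (A⁻¹ * (A * S * (Sᵀ * A * S)⁻¹ * Sᵀ * A)).trace = k := by
    have : A⁻¹ * (A * S * (Sᵀ * A * S)⁻¹ * Sᵀ * A) = (S * (Sᵀ * A * S)⁻¹) * (Sᵀ * A) := by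
      simp only [← Matrix.mul_assoc]
      rw [hA.inv_mul, Matrix.one_mul]
    rw [this, trace_mul_comm, ← Matrix.mul_assoc, hAS.mul_inv, trace_one, Fintype.card_fin]
  rw [blockBFGS, Matrix.mul_add, Matrix.mul_sub, trace_add, trace_sub, t1, t2]
  ring

theorem trace_conj_inv_eq {G A L : Matrix (Fin d) (Fin d) ℝ} (hG : G.PosDef)
    (hL : G⁻¹ = Lᵀ * L) : ((L⁻¹)ᵀ * A⁻¹ * L⁻¹).trace = (A⁻¹ * G).trace := by
  have h : L⁻¹ * (L⁻¹)ᵀ = G := by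
    rw [transpose_nonsing_inv, ← Matrix.mul_inv_rev, ← hL, nonsing_inv_nonsing_inv _ hG.det_isUnit]
  rw [Matrix.mul_assoc, trace_mul_comm, Matrix.mul_assoc, h]

end BlockBFGS

namespace BlockBFGS

open Matrix

variable {d k : ℕ}

/-! ### Norms defined by positive semidefinite matrices. -/

section WeightedNorm

variable {A B : Matrix (Fin d) (Fin d) ℝ}

theorem wnorm_nonneg (A : Matrix (Fin d) (Fin d) ℝ) (v : EuclideanSpace ℝ (Fin d)) :
    0 ≤ wnorm A v := Real.sqrt_nonneg _

theorem wnorm_sq (hA : A.PosSemidef) (v : EuclideanSpace ℝ (Fin d)) :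
    wnorm A v ^ 2 = v.ofLp ⬝ᵥ A *ᵥ v.ofLp :=
  Real.sq_sqrt (hA.dotProduct_mulVec_nonneg _)

theorem wnorm_smul (A : Matrix (Fin d) (Fin d) ℝ) (c : ℝ) (v : EuclideanSpace ℝ (Fin d)) :
    wnorm A (c • v) = |c| * wnorm A v := by
  have : (c • v).ofLp ⬝ᵥ A *ᵥ (c • v).ofLp = c ^ 2 * (v.ofLp ⬝ᵥ A *ᵥ v.ofLp) := by
    simp only [WithLp.ofLp_smul, mulVec_smul, dotProduct_smul, smul_dotProduct, smul_eq_mul]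
    ring
  rw [wnorm, this, Real.sqrt_mul (sq_nonneg c), Real.sqrt_sq_eq_abs, wnorm]

theorem wnorm_neg (A : Matrix (Fin d) (Fin d) ℝ) (v : EuclideanSpace ℝ (Fin d)) :
    wnorm A (-v) = wnorm A v := by
  simpa using wnorm_smul A (-1) v

theorem wnorm_le_of_sq_le (hA : A.PosSemidef) {v : EuclideanSpace ℝ (Fin d)} {c : ℝ} (hc : 0 ≤ c)
    (h : v.ofLp ⬝ᵥ A *ᵥ v.ofLp ≤ c ^ 2) : wnorm A v ≤ c := by
  rw [← wnorm_sq hA] at h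
  exact (sq_le_sq₀ (wnorm_nonneg _ _) hc).1 h

theorem abs_dotProduct_mulVec_le (hA : A.PosSemidef) (u v : EuclideanSpace ℝ (Fin d)) :
    |u.ofLp ⬝ᵥ A *ᵥ v.ofLp| ≤ wnorm A u * wnorm A v := by
  refine abs_le_of_sq_le_sq ?_ (mul_nonneg (wnorm_nonneg _ _) (wnorm_nonneg _ _))
  rw [mul_pow, wnorm_sq hA, wnorm_sq hA]
  exact hA.sq_dotProduct_mulVec_le _ _

theorem wnorm_add_le (hA : A.PosSemidef) (u v : EuclideanSpace ℝ (Fin d)) :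
    wnorm A (u + v) ≤ wnorm A u + wnorm A v := by
  refine wnorm_le_of_sq_le hA (add_nonneg (wnorm_nonneg _ _) (wnorm_nonneg _ _)) ?_
  have h := le_of_abs_le (abs_dotProduct_mulVec_le hA u v)
  have h1 := wnorm_sq hA u
  have h2 := wnorm_sq hA v
  simp only [WithLp.ofLp_add, mulVec_add, dotProduct_add, add_dotProduct]
  rw [dotProduct_mulVec_symm hA.transpose_eq v.ofLp u.ofLp, ← h1, ← h2]
  linarith

/-- If `-c A ≤ K ≤ c A` then `K` is bounded by `c` as a bilinear form on the `A`-norm. -/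
theorem abs_dotProduct_mulVec_le_of_le {K : Matrix (Fin d) (Fin d) ℝ} {c : ℝ} (hc : 0 ≤ c)
    (hA : A.PosSemidef) (h1 : K ≤ c • A) (h2 : -K ≤ c • A) (u v : EuclideanSpace ℝ (Fin d)) :
    |u.ofLp ⬝ᵥ K *ᵥ v.ofLp| ≤ c * (wnorm A u * wnorm A v) := by
  have e1 := (le_iff.1 h1).sq_dotProduct_mulVec_le u.ofLp v.ofLp
  have e2 := (le_iff.1 h2).sq_dotProduct_mulVec_le u.ofLp v.ofLp
  have p1 := (le_iff.1 h1).dotProduct_mulVec_nonneg u.ofLp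
  have p2 := (le_iff.1 h1).dotProduct_mulVec_nonneg v.ofLp
  have p3 := (le_iff.1 h2).dotProduct_mulVec_nonneg u.ofLp
  have p4 := (le_iff.1 h2).dotProduct_mulVec_nonneg v.ofLp
  simp only [star_trivial, sub_neg_eq_add, sub_mulVec, add_mulVec, smul_mulVec, dotProduct_sub,
    dotProduct_add, dotProduct_smul, smul_eq_mul, ← wnorm_sq hA] at e1 e2 p1 p2 p3 p4
  refine abs_le_of_sq_le_sq ?_
    (mul_nonneg hc (mul_nonneg (wnorm_nonneg _ _) (wnorm_nonneg _ _)))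
  generalize u.ofLp ⬝ᵥ K *ᵥ v.ofLp = κ at *
  generalize u.ofLp ⬝ᵥ K *ᵥ u.ofLp = κu at *
  generalize v.ofLp ⬝ᵥ K *ᵥ v.ofLp = κv at *
  generalize u.ofLp ⬝ᵥ A *ᵥ v.ofLp = α at *
  generalize wnorm A u = a at *
  generalize wnorm A v = b at *
  -- Adding `e1` and `e2` gives κ² ≤ c²a²b² + κu κv - c²α². Multiplying them and applying AM–GM
  -- gives κ² ≤ c²a²b² - κu κv + c²α². The average of the two is the claim.
  have key : (2 * ((c * α - κ) * (c * α + κ))) ^ 2 ≤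
      ((c * a ^ 2 - κu) * (c * b ^ 2 + κv) + (c * a ^ 2 + κu) * (c * b ^ 2 - κv)) ^ 2 := by
    have := mul_le_mul e1 e2 (sq_nonneg _) (mul_nonneg p1 p2)
    nlinarith [sq_nonneg ((c * a ^ 2 - κu) * (c * b ^ 2 + κv) -
      (c * a ^ 2 + κu) * (c * b ^ 2 - κv))]
  have key' := abs_le_of_sq_le_sq' key
    (add_nonneg (mul_nonneg p1 p4) (mul_nonneg p3 p2))
  nlinarith [key'.1, key'.2]

theorem wnorm_mono (h : A ≤ B) (v : EuclideanSpace ℝ (Fin d)) :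
    wnorm A v ≤ wnorm B v :=
  Real.sqrt_le_sqrt (dotProduct_mulVec_mono h _)

theorem wnorm_smul_left {c : ℝ} (hc : 0 ≤ c) (A : Matrix (Fin d) (Fin d) ℝ)
    (v : EuclideanSpace ℝ (Fin d)) : wnorm (c • A) v = √c * wnorm A v := by
  rw [wnorm, smul_mulVec, dotProduct_smul, smul_eq_mul, Real.sqrt_mul hc, wnorm]

end WeightedNorm

/-! ### Hessians, strong convexity and self-concordance. -/

section Hessian

variable {f : EuclideanSpace ℝ (Fin d) → ℝ}

theorem hess_mulVec (f : EuclideanSpace ℝ (Fin d) → ℝ) (x v : EuclideanSpace ℝ (Fin d)) :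
    hess f x *ᵥ v.ofLp = (fderiv ℝ (gradient f) x v).ofLp := by
  ext i
  have hv : v = ∑ j, v j • EuclideanSpace.single j (1 : ℝ) := by
    ext i
    simp [Pi.single_apply]
  conv_rhs => rw [hv, map_sum]
  simp [mulVec, dotProduct, hess, mul_comm]

theorem inner_eq_dotProduct (u v : EuclideanSpace ℝ (Fin d)) :
    inner ℝ u v = u.ofLp ⬝ᵥ v.ofLp := by
  rw [EuclideanSpace.inner_eq_star_dotProduct, star_trivial, dotProduct_comm]

theorem hess_transpose (hf : Differentiable ℝ f) (hf' : Differentiable ℝ (gradient f))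
    (x : EuclideanSpace ℝ (Fin d)) : (hess f x)ᵀ = hess f x := by
  have h1 : ∀ y, HasFDerivAt f (innerSL ℝ (gradient f y)) y := fun y =>
    (hf y).hasGradientAt.hasFDerivAt
  have h2 : HasFDerivAt (fun y => innerSL ℝ (gradient f y))
      ((innerSL ℝ (E := EuclideanSpace ℝ (Fin d))).comp (fderiv ℝ (gradient f) x)) x :=
    (innerSL ℝ (E := EuclideanSpace ℝ (Fin d))).hasFDerivAt.comp x (hf' x).hasFDerivAt
  ext i j
  have h := second_derivative_symmetric h1 h2 (EuclideanSpace.single i 1)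
    (EuclideanSpace.single j 1)
  simpa [hess, inner_eq_dotProduct] using h

theorem hasDerivAt_dotProduct_gradient (hf' : Differentiable ℝ (gradient f))
    (x v u : EuclideanSpace ℝ (Fin d)) (s : ℝ) :
    HasDerivAt (fun s : ℝ => u.ofLp ⬝ᵥ (gradient f (x + s • v)).ofLp)
      (u.ofLp ⬝ᵥ hess f (x + s • v) *ᵥ v.ofLp) s := by
  have h1 : HasDerivAt (fun s : ℝ => x + s • v) v s := by
    simpa using ((hasDerivAt_id s).smul_const v).const_add x
  have h2 := (hf' (x + s • v)).hasFDerivAt.comp_hasDerivAt s h1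
  have h3 := (innerSL ℝ u).hasFDerivAt.comp_hasDerivAt s h2
  rw [hess_mulVec, ← inner_eq_dotProduct]
  simp only [← inner_eq_dotProduct]
  exact h3

/-- On a line with direction w, f - (μ/2)‖·‖² is convex, so its derivative is monotone and has
nonnegative derivative at 0; that is wᵀHw ≥ μ‖w‖². -/
theorem hess_posDef (hf : Differentiable ℝ f) (hf' : Differentiable ℝ (gradient f)) {μ : ℝ}
    (hμ : 0 < μ) (hconv : StrongConvexOn Set.univ μ f) (x : EuclideanSpace ℝ (Fin d)) :
    (hess f x).PosDef := by
  refine PosDef.of_dotProduct_mulVec_pos ?_ fun v hv => ?_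
  · simpa [IsHermitian, conjTranspose_eq_transpose_of_trivial] using hess_transpose hf hf' x
  set w : EuclideanSpace ℝ (Fin d) := WithLp.toLp 2 v with hw
  have hw0 : 0 < ‖w‖ ^ 2 := by
    have : w ≠ 0 := fun h => hv (by simpa [hw] using congrArg WithLp.ofLp h)
    positivity
  have hc := strongConvexOn_iff_convex.1 hconv
  have hline : ConvexOn ℝ Set.univ
      (fun s : ℝ => f (x + s • w) - μ / 2 * ‖x + s • w‖ ^ 2) := by
    have := hc.comp_affineMap (AffineMap.lineMap x (x + w) : ℝ →ᵃ[ℝ] EuclideanSpace ℝ (Fin d))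
    simpa [Function.comp_def, AffineMap.lineMap_apply_module', add_comm] using this
  have hd : ∀ s : ℝ, HasDerivAt (fun s : ℝ => f (x + s • w) - μ / 2 * ‖x + s • w‖ ^ 2)
      (w.ofLp ⬝ᵥ (gradient f (x + s • w)).ofLp - μ * (inner ℝ x w + s * ‖w‖ ^ 2)) s := by
    intro s
    have h1 : HasDerivAt (fun s : ℝ => x + s • w) w s := by
      simpa using ((hasDerivAt_id s).smul_const w).const_add x
    have h2 := (hf (x + s • w)).hasGradientAt.hasFDerivAt.comp_hasDerivAt s h1
    have h3 := (h1.norm_sq).const_mul (μ / 2)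
    refine (h2.sub h3).congr_deriv ?_
    rw [← inner_eq_dotProduct, inner_add_left, inner_smul_left, real_inner_self_eq_norm_sq,
      real_inner_comm w]
    simp [real_inner_comm]
    ring
  have hmono : Monotone
      (fun s : ℝ => w.ofLp ⬝ᵥ (gradient f (x + s • w)).ofLp - μ * (inner ℝ x w + s * ‖w‖ ^ 2)) := by
    have h1 := hline.monotoneOn_deriv fun s _ => (hd s).differentiableAt
    have h2 : deriv (fun s : ℝ => f (x + s • w) - μ / 2 * ‖x + s • w‖ ^ 2) = _ :=
      funext fun s => (hd s).deriv
    rwa [h2, monotoneOn_univ] at h1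
  have hd2 := (hasDerivAt_dotProduct_gradient hf' x w w 0).sub
    (((hasDerivAt_id (0 : ℝ)).mul_const (‖w‖ ^ 2)).const_add (inner ℝ x w) |>.const_mul μ)
  have h := hmono.deriv_nonneg (x := 0)
  have h4 := hd2.deriv
  have h5 : (fun s : ℝ => w.ofLp ⬝ᵥ (gradient f (x + s • w)).ofLp -
    μ * (inner ℝ x w + s * ‖w‖ ^ 2)) = ((fun s : ℝ => w.ofLp ⬝ᵥ (gradient f (x + s • w)).ofLp) -
      fun y => μ * (inner ℝ x w + id y * ‖w‖ ^ 2)) := rfl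
  rw [h5, h4] at h
  simp only [zero_smul, add_zero, one_mul] at h
  have : 0 < μ * ‖w‖ ^ 2 := mul_pos hμ hw0
  simp only [star_trivial]
  change 0 < w.ofLp ⬝ᵥ hess f x *ᵥ w.ofLp
  linarith

theorem StronglySelfConcordant.hess_le {M : ℝ} (hM : StronglySelfConcordant M f)
    (x y : EuclideanSpace ℝ (Fin d)) :
    hess f y ≤ (1 + M * wnorm (hess f x) (y - x)) • hess f x := by
  rw [add_smul, one_smul, add_comm, ← sub_le_iff_le_add]
  exact hM.2 x y x x

theorem StronglySelfConcordant.hess_le' {M : ℝ} (hM : StronglySelfConcordant M f)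
    (x y : EuclideanSpace ℝ (Fin d)) :
    hess f x ≤ (1 + M * wnorm (hess f x) (y - x)) • hess f y := by
  rw [add_smul, one_smul, add_comm, ← sub_le_iff_le_add, ← wnorm_neg, neg_sub]
  exact hM.2 y x x y

/-- The error of the linearization of the gradient, in the dual local norm. -/
theorem wnorm_gradient_sub_sub_le (hf' : Differentiable ℝ (gradient f)) {M : ℝ}
    (hM : StronglySelfConcordant M f) (x v : EuclideanSpace ℝ (Fin d))
    (hx : (hess f x).PosDef) :
    wnorm (hess f x)⁻¹ (gradient f (x + v) - gradient f x -
      WithLp.toLp 2 (hess f x *ᵥ v.ofLp)) ≤ M / 2 * wnorm (hess f x) v ^ 2 := by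
  set H := hess f x with hH
  set r := wnorm H v with hr
  set e := gradient f (x + v) - gradient f x - WithLp.toLp 2 (H *ᵥ v.ofLp) with he
  have hr0 : 0 ≤ r := wnorm_nonneg _ _
  have key : ∀ u : EuclideanSpace ℝ (Fin d), |u.ofLp ⬝ᵥ e.ofLp| ≤ M / 2 * r ^ 2 * wnorm H u := by
    intro u
    have hd : ∀ s : ℝ, HasDerivAt (fun s : ℝ => u.ofLp ⬝ᵥ (gradient f (x + s • v)).ofLp -
        u.ofLp ⬝ᵥ (gradient f x).ofLp - s * (u.ofLp ⬝ᵥ H *ᵥ v.ofLp))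
        (u.ofLp ⬝ᵥ (hess f (x + s • v) - H) *ᵥ v.ofLp) s := by
      intro s
      refine (((hasDerivAt_dotProduct_gradient hf' x v u s).sub_const _).sub
        ((hasDerivAt_id s).mul_const _)).congr_deriv ?_
      rw [sub_mulVec, dotProduct_sub, one_mul]
    have hB : ∀ s : ℝ, HasDerivAt (fun s : ℝ => M * r ^ 2 * wnorm H u / 2 * s ^ 2)
        (M * r ^ 2 * wnorm H u * s) s := by
      intro s
      refine ((hasDerivAt_pow 2 s).const_mul _).congr_deriv ?_
      norm_num
      ring
    -- Self-concordance bounds the derivative at s by M r² ‖u‖ s, with ‖u‖ taken in the H-norm.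
    -- Comparison with the primitive of this bound yields the factor 1/2 without integrating the
    -- Hessian.
    have h := image_norm_le_of_norm_deriv_right_le_deriv_boundary (a := 0) (b := 1)
      (fun s _ => (hd s).continuousAt.continuousWithinAt)
      (fun s _ => (hd s).hasDerivWithinAt) (by simp) hB
      (fun s hs => ?_) (Set.right_mem_Icc.2 zero_le_one)
    · rw [Real.norm_eq_abs] at h
      rw [he]
      simp only [one_smul, one_mul, one_pow, mul_one] at h
      simp only [WithLp.ofLp_sub, dotProduct_sub]
      linarith
    · have hs0 : 0 ≤ s := hs.1
      have h1 := hM.2 x (x + s • v) x x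
      have h2 := hM.2 (x + s • v) x x x
      have e1 : x + s • v - x = s • v := by abel
      have e2 : x - (x + s • v) = -(s • v) := by abel
      rw [e1, wnorm_smul, abs_of_nonneg hs0] at h1
      rw [e2, wnorm_neg, wnorm_smul, abs_of_nonneg hs0, ← neg_sub] at h2
      rw [Real.norm_eq_abs]
      refine (abs_dotProduct_mulVec_le_of_le (mul_nonneg hM.1 (mul_nonneg hs0 hr0))
        hx.posSemidef h1 h2 u v).trans (le_of_eq ?_)
      rw [← hr]
      ring
  -- Duality: for u = H⁻¹e the pairing u · e is the squared dual norm of `e`, and the H-norm of u is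
  -- that dual norm, so one factor cancels.
  have h := le_of_abs_le (key (WithLp.toLp 2 (H⁻¹ *ᵥ e.ofLp)))
  have h1 : wnorm H (WithLp.toLp 2 (H⁻¹ *ᵥ e.ofLp)) = wnorm H⁻¹ e := by
    rw [wnorm, wnorm]
    simp only [mulVec_mulVec, hx.mul_inv, one_mulVec]
    rw [dotProduct_comm]
  have h2 := wnorm_sq hx.inv.posSemidef e
  rw [h1] at h
  change (H⁻¹ *ᵥ e.ofLp) ⬝ᵥ e.ofLp ≤ _ at h
  rw [dotProduct_comm, ← h2] at h
  rcases (wnorm_nonneg H⁻¹ e).eq_or_lt with h0 | h0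
  · rw [← h0]
    exact mul_nonneg (div_nonneg hM.1 zero_le_two) (sq_nonneg _)
  · nlinarith

end Hessian

end BlockBFGS

/-! ### One iteration: contraction, preservation of the invariant, and the trace error. -/

namespace Matrix

theorem PosSemidef.diag_le_trace {n : Type*} [Fintype n] {A : Matrix n n ℝ} (hA : A.PosSemidef)
    (i : n) : A i i ≤ A.trace :=
  Finset.single_le_sum (f := fun i => A i i) (fun _ _ => hA.diag_nonneg) (Finset.mem_univ i)

theorem PosSemidef.abs_apply_le_trace {n : Type*} [Fintype n] [DecidableEq n] {A : Matrix n n ℝ}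
    (hA : A.PosSemidef) (i j : n) : |A i j| ≤ A.trace := by
  refine abs_le_of_sq_le_sq ?_ hA.trace_nonneg
  have h := hA.sq_dotProduct_mulVec_le (Pi.single i 1) (Pi.single j 1)
  simp only [mulVec_single_one, single_one_dotProduct, col_apply] at h
  rw [sq A.trace]
  exact h.trans (mul_le_mul (hA.diag_le_trace i) (hA.diag_le_trace j) hA.diag_nonneg
    hA.trace_nonneg)

theorem inv_smul_of_pos {n : Type*} [Fintype n] [DecidableEq n] {A : Matrix n n ℝ} {c : ℝ}
    (hc : 0 < c) (hA : A.PosDef) : (c • A)⁻¹ = c⁻¹ • A⁻¹ := by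
  let _ := invertibleOfNonzero hc.ne'
  rw [inv_smul (k := c) _ hA.det_isUnit, invOf_eq_inv]

theorem smul_le_smul_left {n : Type*} [Fintype n] {A B : Matrix n n ℝ} {c : ℝ} (hc : 0 ≤ c)
    (h : A ≤ B) : c • A ≤ c • B := by
  rw [le_iff, ← smul_sub]
  exact (le_iff.1 h).smul hc

theorem smul_le_smul_right {n : Type*} [Fintype n] {A : Matrix n n ℝ} {b c : ℝ} (h : b ≤ c)
    (hA : A.PosSemidef) : b • A ≤ c • A := by
  rw [le_iff, ← sub_smul]
  exact hA.smul (sub_nonneg.2 h)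

end Matrix

namespace BlockBFGS

open Matrix

variable {d k : ℕ} {f : EuclideanSpace ℝ (Fin d) → ℝ} {M η : ℝ} {s : State d}

/-- The invariant of the method: `∇²f(x) ≤ G ≤ η ∇²f(x)` and `G⁻¹ = Lᵀ L`. -/
structure Invariant (f : EuclideanSpace ℝ (Fin d) → ℝ) (η : ℝ) (s : State d) : Prop where
  one_le : 1 ≤ η
  hess_le : hess f s.x ≤ s.G
  le_hess : s.G ≤ η • hess f s.x
  inv_eq : s.G⁻¹ = s.Lᵀ * s.L

theorem localGradNorm_nonneg (f : EuclideanSpace ℝ (Fin d) → ℝ) (x : EuclideanSpace ℝ (Fin d)) :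
    0 ≤ localGradNorm f x := wnorm_nonneg _ _

theorem State.nextX_sub (f : EuclideanSpace ℝ (Fin d) → ℝ) (s : State d) :
    s.nextX f - s.x = -WithLp.toLp 2 (s.G⁻¹ *ᵥ (gradient f s.x).ofLp) := by
  rw [State.nextX]
  abel

theorem Invariant.posDef (h : Invariant f η s) (hH : (hess f s.x).PosDef) : s.G.PosDef :=
  hH.of_le h.hess_le

/-- The H-norm of the step is at most its G-norm, whose square is gᵀG⁻¹g ≤ gᵀH⁻¹g. -/
theorem Invariant.wnorm_step_le (h : Invariant f η s) (hH : (hess f s.x).PosDef) :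
    wnorm (hess f s.x) (s.nextX f - s.x) ≤ localGradNorm f s.x := by
  have hG := h.posDef hH
  rw [State.nextX_sub, wnorm_neg]
  refine (wnorm_mono h.hess_le _).trans ?_
  refine Real.sqrt_le_sqrt ?_
  have := dotProduct_mulVec_mono (hH.inv_antitone h.hess_le) (gradient f s.x).ofLp
  simp only [mulVec_mulVec, hG.mul_inv, one_mulVec]
  rwa [dotProduct_comm]

theorem one_le_corr (hM : 0 ≤ M) (f : EuclideanSpace ℝ (Fin d) → ℝ) (s : State d) :
    1 ≤ s.corr f M :=
  le_add_of_nonneg_right (mul_nonneg hM (wnorm_nonneg _ _))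

theorem Invariant.corr_le (h : Invariant f η s) (hM : 0 ≤ M) (hH : (hess f s.x).PosDef) :
    s.corr f M ≤ 1 + M * localGradNorm f s.x :=
  add_le_add_right (mul_le_mul_of_nonneg_left (h.wnorm_step_le hH) hM) 1

/-- The linear model of the gradient after the step is H (H⁻¹ - G⁻¹) g, and 0 ≤ H⁻¹ - G⁻¹ ≤ (1 -
1/η) H⁻¹. -/
theorem Invariant.wnorm_linear_le (h : Invariant f η s) (hH : (hess f s.x).PosDef) :
    wnorm (hess f s.x)⁻¹ (gradient f s.x +
      WithLp.toLp 2 (hess f s.x *ᵥ (s.nextX f - s.x).ofLp)) ≤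
      (1 - 1 / η) * localGradNorm f s.x := by
  have hη : 0 < η := zero_lt_one.trans_le h.one_le
  have hG := h.posDef hH
  set H := hess f s.x with hHdef
  set g := (gradient f s.x).ofLp with hg
  have hX : (H⁻¹ - s.G⁻¹).PosSemidef := le_iff.1 (hH.inv_antitone h.hess_le)
  have hXle : H⁻¹ - s.G⁻¹ ≤ (1 - 1 / η) • H⁻¹ := by
    have := hG.inv_antitone h.le_hess
    rw [inv_smul_of_pos hη hH] at this
    rw [sub_smul, one_smul, one_div]
    exact sub_le_sub_left this _
  have hnn : 0 ≤ 1 - 1 / η := by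
    rw [sub_nonneg, div_le_one hη]
    exact h.one_le
  refine wnorm_le_of_sq_le hH.inv.posSemidef (mul_nonneg hnn (localGradNorm_nonneg _ _)) ?_
  have e : (gradient f s.x + WithLp.toLp 2 (H *ᵥ (s.nextX f - s.x).ofLp)).ofLp =
      H *ᵥ ((H⁻¹ - s.G⁻¹) *ᵥ g) := by
    rw [State.nextX_sub, sub_mulVec, mulVec_sub, mulVec_mulVec, hH.mul_inv, one_mulVec]
    simp [mulVec_neg, sub_eq_add_neg, hg]
  rw [e, mulVec_mulVec (M := H⁻¹), hH.inv_mul, one_mulVec, dotProduct_comm, mul_pow,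
    localGradNorm, wnorm_sq hH.inv.posSemidef]
  exact hX.dotProduct_mul_mul_mulVec_le hH hXle g

theorem inv_hess_nextX_le (hM : StronglySelfConcordant M f) (hH : ∀ x, (hess f x).PosDef) :
    (hess f (s.nextX f))⁻¹ ≤ s.corr f M • (hess f s.x)⁻¹ := by
  have hc0 : 0 < s.corr f M := zero_lt_one.trans_le (one_le_corr hM.1 f s)
  have := (hH s.x).inv_antitone (hM.hess_le' s.x (s.nextX f))
  change (s.corr f M • hess f (s.nextX f))⁻¹ ≤ _ at this
  rw [inv_smul_of_pos hc0 (hH _)] at this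
  have := smul_le_smul_left hc0.le this
  rwa [smul_smul, mul_inv_cancel₀ hc0.ne', one_smul] at this

/-- One quasi-Newton step contracts the local gradient norm. -/
theorem Invariant.localGradNorm_nextX_le (h : Invariant f η s)
    (hf' : Differentiable ℝ (gradient f)) (hM : StronglySelfConcordant M f)
    (hH : ∀ x, (hess f x).PosDef) :
    localGradNorm f (s.nextX f) ≤ (1 + M * localGradNorm f s.x / 2) *
      ((1 - 1 / η) + M * localGradNorm f s.x / 2) * localGradNorm f s.x := by
  have hc1 := one_le_corr hM.1 f s
  have hc2 := h.corr_le hM.1 (hH s.x)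
  have hc0 : 0 < s.corr f M := zero_lt_one.trans_le hc1
  have hr := h.wnorm_step_le (hH s.x)
  have hr0 := wnorm_nonneg (hess f s.x) (s.nextX f - s.x)
  have hl := localGradNorm_nonneg f s.x
  have hMl : 0 ≤ M * localGradNorm f s.x := mul_nonneg hM.1 hl
  have h1 := inv_hess_nextX_le (s := s) hM hH
  have h2 : localGradNorm f (s.nextX f) ≤
      √(s.corr f M) * wnorm (hess f s.x)⁻¹ (gradient f (s.nextX f)) := by
    rw [← wnorm_smul_left hc0.le]
    exact wnorm_mono h1 _
  have h3 : √(s.corr f M) ≤ 1 + M * localGradNorm f s.x / 2 := by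
    refine Real.sqrt_le_iff.2 ⟨by positivity, hc2.trans ?_⟩
    nlinarith [sq_nonneg (M * localGradNorm f s.x)]
  -- The new gradient is the linear model plus the linearization error; the latter is at most (M/2)
  -- λ², since the step is no longer than λ.
  have h4 : wnorm (hess f s.x)⁻¹ (gradient f (s.nextX f)) ≤
      ((1 - 1 / η) + M * localGradNorm f s.x / 2) * localGradNorm f s.x := by
    have e1 := wnorm_gradient_sub_sub_le hf' hM s.x (s.nextX f - s.x) (hH s.x)
    have e2 := h.wnorm_linear_le (hH s.x)
    rw [add_sub_cancel] at e1
    have e3 := wnorm_add_le (hH s.x).inv.posSemidef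
      (gradient f (s.nextX f) - gradient f s.x -
        WithLp.toLp 2 (hess f s.x *ᵥ (s.nextX f - s.x).ofLp))
      (gradient f s.x + WithLp.toLp 2 (hess f s.x *ᵥ (s.nextX f - s.x).ofLp))
    rw [sub_sub, sub_add_cancel] at e3
    rw [sub_sub] at e1
    have e4 : M / 2 * wnorm (hess f s.x) (s.nextX f - s.x) ^ 2 ≤
        M / 2 * localGradNorm f s.x ^ 2 :=
      mul_le_mul_of_nonneg_left (pow_le_pow_left₀ hr0 hr 2) (div_nonneg hM.1 zero_le_two)
    linarith
  refine h2.trans ?_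
  rw [mul_assoc]
  exact mul_le_mul h3 h4 (wnorm_nonneg _ _) (by positivity)

/-- The rescaled estimator used by an update. -/
noncomputable def State.scaledG (f : EuclideanSpace ℝ (Fin d) → ℝ) (M : ℝ) (s : State d) :
    Matrix (Fin d) (Fin d) ℝ := s.corr f M • s.G

/-- The rescaled factor used by an update. -/
noncomputable def State.scaledL (f : EuclideanSpace ℝ (Fin d) → ℝ) (M : ℝ) (s : State d) :
    Matrix (Fin d) (Fin d) ℝ := (√(s.corr f M))⁻¹ • s.L

theorem State.step_x (U : Matrix (Fin d) (Fin k) ℝ) : (s.step f M U).x = s.nextX f := rfl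

theorem State.step_G (U : Matrix (Fin d) (Fin k) ℝ) :
    (s.step f M U).G =
      blockBFGS (s.scaledG f M) (hess f (s.nextX f)) ((s.scaledL f M)ᵀ * U) := rfl

/-- The purpose of the correction factor: it makes up for the largest growth of the Hessian that
self-concordance allows along the step. -/
theorem Invariant.hess_nextX_le_scaledG (h : Invariant f η s) (hM : StronglySelfConcordant M f) :
    hess f (s.nextX f) ≤ s.scaledG f M :=
  (hM.hess_le s.x (s.nextX f)).trans
    (smul_le_smul_left (zero_le_one.trans (one_le_corr hM.1 f s)) h.hess_le)

theorem Invariant.scaledG_posDef (h : Invariant f η s) (hM : StronglySelfConcordant M f)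
    (hH : ∀ x, (hess f x).PosDef) : (s.scaledG f M).PosDef :=
  (hH _).of_le (h.hess_nextX_le_scaledG hM)

theorem Invariant.scaledG_inv (h : Invariant f η s) (hM : StronglySelfConcordant M f)
    (hH : ∀ x, (hess f x).PosDef) : (s.scaledG f M)⁻¹ = (s.scaledL f M)ᵀ * s.scaledL f M := by
  have hc : 0 < s.corr f M := zero_lt_one.trans_le (one_le_corr hM.1 f s)
  rw [State.scaledG, State.scaledL, inv_smul_of_pos hc (h.posDef (hH _)), h.inv_eq,
    transpose_smul, Matrix.smul_mul, Matrix.mul_smul, smul_smul, ← mul_inv,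
    Real.mul_self_sqrt hc.le]

/-- The correction factor enters twice, once in rescaling `G` and once in passing to the new
Hessian. The update itself does not worsen η, and no rank condition on `U` is needed. -/
theorem Invariant.step (h : Invariant f η s) (hM : StronglySelfConcordant M f)
    (hH : ∀ x, (hess f x).PosDef) (U : Matrix (Fin d) (Fin k) ℝ) {η' : ℝ}
    (hη' : (1 + M * localGradNorm f s.x) ^ 2 * η ≤ η') : Invariant f η' (s.step f M U) := by
  have hc1 := one_le_corr hM.1 f s
  have hc2 := h.corr_le hM.1 (hH s.x)
  have hc0 : 0 < s.corr f M := zero_lt_one.trans_le hc1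
  have h1 := h.one_le
  have hle : s.corr f M * η * s.corr f M ≤ η' := by
    refine le_trans ?_ hη'
    have := mul_le_mul hc2 hc2 hc0.le (hc0.le.trans hc2)
    nlinarith
  have hone : 1 ≤ η' := by
    refine le_trans ?_ hle
    exact one_le_mul_of_one_le_of_one_le (one_le_mul_of_one_le_of_one_le hc1 h1) hc1
  have hG := h.scaledG_posDef hM hH
  refine ⟨hone, ?_, ?_, ?_⟩
  · exact le_blockBFGS (hH _) (h.hess_nextX_le_scaledG hM) _
  · refine blockBFGS_le (hH _) hG hone ?_ _
    calc s.scaledG f M ≤ s.corr f M • (η • hess f s.x) := smul_le_smul_left hc0.le h.le_hess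
      _ ≤ (s.corr f M * η) • (s.corr f M • hess f (s.nextX f)) := by
        rw [smul_smul]
        exact smul_le_smul_left (by positivity) (hM.hess_le' s.x (s.nextX f))
      _ ≤ η' • hess f (s.nextX f) := by
        rw [smul_smul]
        exact smul_le_smul_right hle (hH _).posSemidef
  · exact inv_blockBFGS_eq hG (hH _) (h.scaledG_inv hM hH) U

/-- The accuracy `tr (∇²f(x)⁻¹ G) - d` of the Hessian estimator. -/
noncomputable def State.sigma (f : EuclideanSpace ℝ (Fin d) → ℝ) (s : State d) : ℝ :=
  ((hess f s.x)⁻¹ * s.G).trace - d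

theorem trace_inv_mul_self {A : Matrix (Fin d) (Fin d) ℝ} (hA : A.PosDef) :
    (A⁻¹ * A).trace = d := by
  rw [hA.inv_mul, trace_one, Fintype.card_fin]

theorem Invariant.sigma_nonneg (h : Invariant f η s) (hH : (hess f s.x).PosDef) :
    0 ≤ s.sigma f := by
  have := trace_mul_le_trace_mul h.hess_le hH.inv.posSemidef
  rw [trace_mul_comm, trace_inv_mul_self hH, trace_mul_comm] at this
  exact sub_nonneg.2 this

theorem Invariant.sigma_le (h : Invariant f η s) (hH : (hess f s.x).PosDef) :
    s.sigma f ≤ d * (η - 1) := by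
  have := trace_mul_le_trace_mul h.le_hess hH.inv.posSemidef
  rw [trace_mul_comm, Matrix.smul_mul, trace_smul, trace_mul_comm (hess f s.x),
    trace_inv_mul_self hH, smul_eq_mul] at this
  rw [State.sigma]
  linarith

/-- Replaces a uniform η by the accuracy actually reached along the trajectory. A positive
semidefinite G - H is bounded by tr(H⁻¹(G - H)) H. -/
theorem Invariant.of_sigma (h : Invariant f η s) (hH : (hess f s.x).PosDef) :
    Invariant f (1 + s.sigma f) s := by
  refine ⟨le_add_of_nonneg_right (h.sigma_nonneg hH), h.hess_le, ?_, h.inv_eq⟩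
  have := (le_iff.1 h.hess_le).le_trace_inv_mul_smul hH
  rw [Matrix.mul_sub, trace_sub, trace_inv_mul_self hH] at this
  rw [add_smul, one_smul, add_comm, ← sub_le_iff_le_add]
  exact this

/-- The matrix whose pairing with the projection onto the range of `U` is the decrease of
`tr (∇²f(x₊)⁻¹ G)` in an update. -/
noncomputable def State.gain (f : EuclideanSpace ℝ (Fin d) → ℝ) (M : ℝ) (s : State d) :
    Matrix (Fin d) (Fin d) ℝ :=
  ((s.scaledL f M)⁻¹)ᵀ * (hess f (s.nextX f))⁻¹ * (s.scaledL f M)⁻¹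

theorem Invariant.trace_gain (h : Invariant f η s) (hM : StronglySelfConcordant M f)
    (hH : ∀ x, (hess f x).PosDef) :
    (s.gain f M).trace = ((hess f (s.nextX f))⁻¹ * s.scaledG f M).trace :=
  trace_conj_inv_eq (h.scaledG_posDef hM hH) (h.scaledG_inv hM hH)

theorem gain_posSemidef (hH : ∀ x, (hess f x).PosDef) : (s.gain f M).PosSemidef := by
  simpa [State.gain, conjTranspose_eq_transpose_of_trivial] using
    (hH (s.nextX f)).inv.posSemidef.conjTranspose_mul_mul_same (s.scaledL f M)⁻¹

theorem Invariant.trace_gain_le (h : Invariant f η s) (hM : StronglySelfConcordant M f)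
    (hH : ∀ x, (hess f x).PosDef) :
    (s.gain f M).trace ≤ (1 + M * localGradNorm f s.x) ^ 2 * (s.sigma f + d) := by
  have hc1 := one_le_corr hM.1 f s
  have hc2 := h.corr_le hM.1 (hH s.x)
  have hc0 : 0 < s.corr f M := zero_lt_one.trans_le hc1
  have hG := h.posDef (hH _)
  have h1 := inv_hess_nextX_le (s := s) hM hH
  have h2 := trace_mul_le_trace_mul h1 (h.scaledG_posDef hM hH).posSemidef
  rw [State.scaledG, Matrix.mul_smul, Matrix.mul_smul, Matrix.smul_mul, trace_smul, trace_smul,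
    trace_smul, smul_smul] at h2
  have h3 : 0 ≤ ((hess f s.x)⁻¹ * s.G).trace :=
    (hH s.x).inv.posSemidef.trace_mul_nonneg hG.posSemidef
  rw [h.trace_gain hM hH, State.scaledG, Matrix.mul_smul, trace_smul]
  refine h2.trans ?_
  rw [State.sigma, sub_add_cancel, smul_eq_mul, ← sq]
  exact mul_le_mul_of_nonneg_right (pow_le_pow_left₀ hc0.le hc2 2) h3

theorem Invariant.sigma_step (h : Invariant f η s) (hM : StronglySelfConcordant M f)
    (hH : ∀ x, (hess f x).PosDef) {U : Matrix (Fin d) (Fin k) ℝ} (hU : IsUnit (Uᵀ * U).det) :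
    (s.step f M U).sigma f = (s.gain f M).trace + k -
      (s.gain f M * (U * (Uᵀ * U)⁻¹ * Uᵀ)).trace - d := by
  rw [State.sigma, State.step_x, State.step_G, trace_inv_mul_blockBFGS (h.scaledG_posDef hM hH)
    (hH _) (h.scaledG_inv hM hH) hU, h.trace_gain hM hH, State.gain]

end BlockBFGS

/-! ### Measurability of the matrix operations and of the algorithm. -/

namespace Matrix

variable {α : Type*} [MeasurableSpace α] {l m n : ℕ}

instance instMeasurableSpaceFin : MeasurableSpace (Matrix (Fin m) (Fin n) ℝ) :=
  inferInstanceAs (MeasurableSpace (Fin m → Fin n → ℝ))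

instance instBorelSpaceFin : BorelSpace (Matrix (Fin m) (Fin n) ℝ) :=
  inferInstanceAs (BorelSpace (Fin m → Fin n → ℝ))

theorem measurable_iff {A : α → Matrix (Fin m) (Fin n) ℝ} :
    Measurable A ↔ ∀ i j, Measurable fun a => A a i j :=
  ⟨fun h i j => measurable_pi_iff.1 (measurable_pi_iff.1 h i) j,
    fun h => measurable_pi_iff.2 fun i => measurable_pi_iff.2 fun j => h i j⟩

theorem _root_.Measurable.matrix_apply {A : α → Matrix (Fin m) (Fin n) ℝ} (hA : Measurable A)
    (i : Fin m) (j : Fin n) : Measurable fun a => A a i j :=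
  measurable_iff.1 hA i j

theorem _root_.Measurable.matrix_mul {A : α → Matrix (Fin l) (Fin m) ℝ}
    {B : α → Matrix (Fin m) (Fin n) ℝ} (hA : Measurable A) (hB : Measurable B) :
    Measurable fun a => A a * B a := by
  refine measurable_iff.2 fun i j => ?_
  simp only [mul_apply]
  exact Finset.measurable_fun_sum _ fun x _ => (hA.matrix_apply i x).mul (hB.matrix_apply x j)

theorem _root_.Measurable.matrix_add {A B : α → Matrix (Fin m) (Fin n) ℝ} (hA : Measurable A)
    (hB : Measurable B) : Measurable fun a => A a + B a :=
  measurable_iff.2 fun i j => (hA.matrix_apply i j).add (hB.matrix_apply i j)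

theorem _root_.Measurable.matrix_sub {A B : α → Matrix (Fin m) (Fin n) ℝ} (hA : Measurable A)
    (hB : Measurable B) : Measurable fun a => A a - B a :=
  measurable_iff.2 fun i j => (hA.matrix_apply i j).sub (hB.matrix_apply i j)

theorem _root_.Measurable.matrix_smul {c : α → ℝ} {A : α → Matrix (Fin m) (Fin n) ℝ}
    (hc : Measurable c) (hA : Measurable A) : Measurable fun a => c a • A a :=
  measurable_iff.2 fun i j => hc.mul (hA.matrix_apply i j)

theorem _root_.Measurable.matrix_transpose {A : α → Matrix (Fin m) (Fin n) ℝ}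
    (hA : Measurable A) : Measurable fun a => (A a)ᵀ :=
  measurable_iff.2 fun i j => hA.matrix_apply j i

theorem _root_.Measurable.matrix_det {A : α → Matrix (Fin n) (Fin n) ℝ} (hA : Measurable A) :
    Measurable fun a => (A a).det :=
  (continuous_id.matrix_det).measurable.comp hA

theorem _root_.Measurable.matrix_trace {A : α → Matrix (Fin n) (Fin n) ℝ} (hA : Measurable A) :
    Measurable fun a => (A a).trace :=
  (continuous_id.matrix_trace).measurable.comp hA

theorem _root_.Measurable.matrix_inv {A : α → Matrix (Fin n) (Fin n) ℝ} (hA : Measurable A) :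
    Measurable fun a => (A a)⁻¹ := by
  simp only [inv_def, Ring.inverse_eq_inv']
  exact hA.matrix_det.inv.matrix_smul ((continuous_id.matrix_adjugate).measurable.comp hA)

theorem _root_.Measurable.matrix_mulVec {A : α → Matrix (Fin m) (Fin n) ℝ} {v : α → Fin n → ℝ}
    (hA : Measurable A) (hv : Measurable v) : Measurable fun a => A a *ᵥ v a := by
  refine measurable_pi_iff.2 fun i => ?_
  simp only [mulVec, dotProduct]
  exact Finset.measurable_fun_sum _ fun x _ => (hA.matrix_apply i x).mul (measurable_pi_iff.1 hv x)

theorem _root_.Measurable.dotProduct {u v : α → Fin n → ℝ} (hu : Measurable u)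
    (hv : Measurable v) : Measurable fun a => u a ⬝ᵥ v a := by
  simp only [_root_.dotProduct]
  exact Finset.measurable_fun_sum _ fun x _ => (measurable_pi_iff.1 hu x).mul (measurable_pi_iff.1 hv x)

open scoped Matrix.Norms.L2Operator in
theorem continuousOn_sqrt :
    ContinuousOn (fun A : Matrix (Fin n) (Fin n) ℝ => CFC.sqrt A) {A | 0 ≤ A} :=
  CFC.continuousOn_sqrt

theorem isClosed_nonneg : IsClosed {A : Matrix (Fin n) (Fin n) ℝ | 0 ≤ A} := by
  have : {A : Matrix (Fin n) (Fin n) ℝ | 0 ≤ A} =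
      {A | Aᵀ = A} ∩ ⋂ v : Fin n → ℝ, {A | 0 ≤ v ⬝ᵥ A *ᵥ v} := by
    ext A
    simp only [Set.mem_ofPred_eq, Set.mem_inter_iff, Set.mem_iInter]
    refine ⟨fun h => ?_, fun h =>
      le_of_dotProduct_mulVec_le (transpose_zero) h.1 fun v => by simpa using h.2 v⟩
    have hA : A.PosSemidef := nonneg_iff_posSemidef.1 h
    exact ⟨hA.transpose_eq, fun v => hA.dotProduct_mulVec_nonneg v⟩
  rw [this]
  refine (isClosed_eq continuous_id.matrix_transpose continuous_id).inter
    (isClosed_iInter fun v => isClosed_le continuous_const ?_)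
  exact continuous_const.dotProduct (continuous_id.matrix_mulVec continuous_const)

/-- The square root is continuous on the closed cone of positive semidefinite matrices and has the
default value 0 off it. -/
theorem measurable_sqrt : Measurable fun A : Matrix (Fin n) (Fin n) ℝ => CFC.sqrt A := by
  classical
  have h : (fun A : Matrix (Fin n) (Fin n) ℝ => CFC.sqrt A) =
      Set.piecewise {A | 0 ≤ A} (fun A => CFC.sqrt A) fun _ => 0 := by
    ext1 A
    by_cases hA : 0 ≤ A
    · rw [Set.piecewise_eq_of_mem {A : Matrix (Fin n) (Fin n) ℝ | 0 ≤ A} _ _ hA]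
    · rw [Set.piecewise_eq_of_notMem {A : Matrix (Fin n) (Fin n) ℝ | 0 ≤ A} _ _ hA]
      exact cfcₙ_apply_of_not_predicate A hA
  rw [h]
  exact continuousOn_sqrt.measurable_piecewise continuousOn_const isClosed_nonneg.measurableSet

end Matrix

namespace BlockBFGS

open Matrix

section Measurability

variable {α : Type*} [MeasurableSpace α] {d k : ℕ}

theorem measurable_invSqrt {A : α → Matrix (Fin k) (Fin k) ℝ} (hA : Measurable A) :
    Measurable fun a => invSqrt (A a) :=
  measurable_sqrt.comp hA.matrix_inv

theorem measurable_blockBFGS {G A : α → Matrix (Fin d) (Fin d) ℝ}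
    {U : α → Matrix (Fin d) (Fin k) ℝ} (hG : Measurable G) (hA : Measurable A)
    (hU : Measurable U) : Measurable fun a => blockBFGS (G a) (A a) (U a) := by
  have h1 := hU.matrix_transpose
  exact (hG.matrix_sub (((((hG.matrix_mul hU).matrix_mul
    ((h1.matrix_mul hG).matrix_mul hU).matrix_inv).matrix_mul h1).matrix_mul hG))).matrix_add
    ((((hA.matrix_mul hU).matrix_mul
      ((h1.matrix_mul hA).matrix_mul hU).matrix_inv).matrix_mul h1).matrix_mul hA)

theorem measurable_updateL {L A : α → Matrix (Fin d) (Fin d) ℝ}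
    {U : α → Matrix (Fin d) (Fin k) ℝ} (hL : Measurable L) (hA : Measurable A)
    (hU : Measurable U) : Measurable fun a => updateL (L a) (A a) (U a) := by
  have h1 := hU.matrix_transpose
  have hW := measurable_invSqrt
    ((((h1.matrix_mul hL).matrix_mul hA).matrix_mul hL.matrix_transpose).matrix_mul hU)
  have hV := measurable_invSqrt (h1.matrix_mul hU)
  exact hL.matrix_add (((((hU.matrix_mul hV).matrix_sub
    ((((hL.matrix_mul hA).matrix_mul hL.matrix_transpose).matrix_mul hU).matrix_mul
      hW)).matrix_mul hW).matrix_mul h1).matrix_mul hL)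

theorem measurable_wnorm {A : α → Matrix (Fin d) (Fin d) ℝ}
    {v : α → EuclideanSpace ℝ (Fin d)} (hA : Measurable A) (hv : Measurable v) :
    Measurable fun a => wnorm (A a) (v a) := by
  have h : Measurable fun a => (v a).ofLp := (WithLp.measurable_ofLp 2 _).comp hv
  exact (h.dotProduct (hA.matrix_mulVec h)).sqrt

variable {f : EuclideanSpace ℝ (Fin d) → ℝ}

theorem measurable_hess (f : EuclideanSpace ℝ (Fin d) → ℝ) : Measurable (hess f) := by
  refine measurable_iff.2 fun i j => ?_
  have h := measurable_fderiv_apply_const ℝ (gradient f) (EuclideanSpace.single j (1 : ℝ))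
  exact (measurable_pi_apply i).comp ((WithLp.measurable_ofLp 2 _).comp h)

theorem measurable_localGradNorm (hf' : Differentiable ℝ (gradient f)) :
    Measurable (localGradNorm f) :=
  measurable_wnorm (measurable_hess f).matrix_inv hf'.continuous.measurable

/-- Measurability of a family of states: all three components are measurable. -/
structure MeasurableState (s : α → State d) : Prop where
  x : Measurable fun a => (s a).x
  G : Measurable fun a => (s a).G
  L : Measurable fun a => (s a).L

variable {s : α → State d} {M : ℝ}

theorem MeasurableState.nextX (h : MeasurableState s) (hf' : Differentiable ℝ (gradient f)) :
    Measurable fun a => (s a).nextX f := by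
  refine h.x.sub ((WithLp.measurable_toLp 2 _).comp (h.G.matrix_inv.matrix_mulVec ?_))
  exact (WithLp.measurable_ofLp 2 _).comp (hf'.continuous.measurable.comp h.x)

theorem MeasurableState.corr (h : MeasurableState s) (hf' : Differentiable ℝ (gradient f)) (M : ℝ) :
    Measurable fun a => (s a).corr f M :=
  ((measurable_wnorm ((measurable_hess f).comp h.x) ((h.nextX hf').sub h.x)).const_mul M).const_add 1

theorem MeasurableState.scaledL (h : MeasurableState s) (hf' : Differentiable ℝ (gradient f))
    (M : ℝ) : Measurable fun a => (s a).scaledL f M :=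
  (h.corr hf' M).sqrt.inv.matrix_smul h.L

theorem MeasurableState.step (h : MeasurableState s) (hf' : Differentiable ℝ (gradient f)) (M : ℝ)
    {U : α → Matrix (Fin d) (Fin k) ℝ} (hU : Measurable U) :
    MeasurableState fun a => (s a).step f M (U a) := by
  have hH := (measurable_hess f).comp (h.nextX hf')
  exact ⟨h.nextX hf',
    measurable_blockBFGS ((h.corr hf' M).matrix_smul h.G) hH
      ((h.scaledL hf' M).matrix_transpose.matrix_mul hU),
    measurable_updateL (h.scaledL hf' M) hH hU⟩

theorem MeasurableState.gain (h : MeasurableState s) (hf' : Differentiable ℝ (gradient f)) (M : ℝ) :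
    Measurable fun a => (s a).gain f M := by
  have hL := (h.scaledL hf' M).matrix_inv
  exact (hL.matrix_transpose.matrix_mul
    ((measurable_hess f).comp (h.nextX hf')).matrix_inv).matrix_mul hL

theorem MeasurableState.sigma (h : MeasurableState s) (f : EuclideanSpace ℝ (Fin d) → ℝ) :
    Measurable fun a => (s a).sigma f :=
  (((measurable_hess f).comp h.x).matrix_inv.matrix_mul h.G).matrix_trace.sub_const _

theorem measurableState_run (hf' : Differentiable ℝ (gradient f)) (M : ℝ) (s₀ : State d)
    {U : α → ℕ → Matrix (Fin d) (Fin k) ℝ} (hU : ∀ t, Measurable fun a => U a t) (t : ℕ) :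
    MeasurableState fun a => run f M s₀ (U a) t := by
  induction t with
  | zero =>
    exact ⟨measurable_const (a := s₀.x), measurable_const (a := s₀.G), measurable_const (a := s₀.L)⟩
  | succ t ih => exact ih.step hf' M (hU t)

/-- The state depends on the past directions alone; this is the source of its independence from the
current one. -/
theorem run_congr (f : EuclideanSpace ℝ (Fin d) → ℝ) (M : ℝ) (s₀ : State d)
    {U V : ℕ → Matrix (Fin d) (Fin k) ℝ} {t : ℕ} (h : ∀ s < t, U s = V s) :
    run f M s₀ U t = run f M s₀ V t := by
  induction t with
  | zero => rfl
  | succ t ih =>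
    rw [run, run, ih fun s hs => h s (hs.trans t.lt_succ_self), h t t.lt_succ_self]

end Measurability

/-! ### The projection onto the range of the direction matrix and its symmetries. -/

section Projection

variable {d k : ℕ}

/-- The orthogonal projection onto the range of `U` (zero if `U` is rank deficient). -/
noncomputable def rangeProj (U : Matrix (Fin d) (Fin k) ℝ) : Matrix (Fin d) (Fin d) ℝ :=
  U * (Uᵀ * U)⁻¹ * Uᵀ

theorem rangeProj_posSemidef (U : Matrix (Fin d) (Fin k) ℝ) : (rangeProj U).PosSemidef := by
  have h := posSemidef_conjTranspose_mul_self U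
  simpa [conjTranspose_eq_transpose_of_trivial, rangeProj] using h.inv.mul_mul_conjTranspose_same U

theorem trace_rangeProj {U : Matrix (Fin d) (Fin k) ℝ} (hU : IsUnit (Uᵀ * U).det) :
    (rangeProj U).trace = k := by
  rw [rangeProj, trace_mul_comm, ← Matrix.mul_assoc, mul_nonsing_inv _ hU, trace_one,
    Fintype.card_fin]

theorem trace_rangeProj_le (U : Matrix (Fin d) (Fin k) ℝ) : (rangeProj U).trace ≤ k := by
  by_cases hU : IsUnit (Uᵀ * U).det
  · exact (trace_rangeProj hU).le
  · simp [rangeProj, nonsing_inv_apply_not_isUnit _ hU]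

theorem abs_rangeProj_le (U : Matrix (Fin d) (Fin k) ℝ) (i j : Fin d) : |rangeProj U i j| ≤ k :=
  ((rangeProj_posSemidef U).abs_apply_le_trace i j).trans (trace_rangeProj_le U)

theorem measurable_rangeProj : Measurable (rangeProj : Matrix (Fin d) (Fin k) ℝ → _) := by
  have h : Measurable fun U : Matrix (Fin d) (Fin k) ℝ => U := measurable_id
  exact (h.matrix_mul (h.matrix_transpose.matrix_mul h).matrix_inv).matrix_mul h.matrix_transpose

/-- Row permutations, like the row sign changes below, leave UᵀU unchanged and hence conjugate the
projection. These two symmetries suffice to determine its Gaussian mean. -/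
theorem rangeProj_submatrix (U : Matrix (Fin d) (Fin k) ℝ) (σ : Equiv.Perm (Fin d)) (i j : Fin d) :
    rangeProj (U.submatrix σ id) i j = rangeProj U (σ i) (σ j) := by
  have h : (U.submatrix σ id)ᵀ * U.submatrix σ id = Uᵀ * U := by
    rw [transpose_submatrix, submatrix_mul_equiv, submatrix_id_id]
  rw [rangeProj, h]
  rfl

theorem rangeProj_diagonal_mul (U : Matrix (Fin d) (Fin k) ℝ) {ε : Fin d → ℝ}
    (hε : ∀ i, ε i * ε i = 1) (i j : Fin d) :
    rangeProj (diagonal ε * U) i j = ε i * ε j * rangeProj U i j := by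
  have h : (diagonal ε * U)ᵀ * (diagonal ε * U) = Uᵀ * U := by
    rw [transpose_mul, Matrix.mul_assoc, ← Matrix.mul_assoc _ᵀ (diagonal ε), diagonal_transpose,
      diagonal_mul_diagonal]
    simp [hε]
  have h' : rangeProj (diagonal ε * U) = diagonal ε * rangeProj U * diagonal ε := by
    rw [rangeProj, h, transpose_mul, diagonal_transpose, rangeProj]
    simp only [Matrix.mul_assoc]
  rw [h', mul_diagonal, diagonal_mul]
  ring

end Projection

end BlockBFGS

namespace BlockBFGS

open Matrix

/-! ### Almost sure full rank. -/

section FullRank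

variable {Ω : Type*} [MeasurableSpace Ω] {P : Measure Ω} [IsProbabilityMeasure P]

/-- A nonconstant affine function of an atomless random variable, whose coefficients are
independent of that variable, is almost surely nonzero. -/
theorem ae_mul_add_ne_zero {X : Ω → ℝ} {Y : Ω → ℝ × ℝ} (hX : Measurable X) (hY : Measurable Y)
    (hXY : IndepFun Y X P) [NullSingletonClass (P.map X)] (h : ∀ᵐ ω ∂P, (Y ω).1 ≠ 0) :
    ∀ᵐ ω ∂P, X ω * (Y ω).1 + (Y ω).2 ≠ 0 := by
  have hmap := (indepFun_iff_map_prod_eq_prod_map_map hY.aemeasurable hX.aemeasurable).1 hXY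
  set Z : Set ((ℝ × ℝ) × ℝ) := {z | z.1.1 ≠ 0 ∧ z.2 * z.1.1 + z.1.2 = 0} with hZ
  have hZm : MeasurableSet Z := by
    refine MeasurableSet.inter ?_ ?_
    · exact (measurableSet_eq_fun (measurable_fst.comp measurable_fst) measurable_const).compl
    · exact measurableSet_eq_fun (by fun_prop) measurable_const
  have : IsProbabilityMeasure (P.map X) := Measure.isProbabilityMeasure_map hX.aemeasurable
  have hZ0 : ((P.map Y).prod (P.map X)) Z = 0 := by
    -- By Fubini it suffices that, for fixed coefficients, the only root is a single point, which is
    -- null.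
    rw [Measure.measure_prod_null hZm]
    refine Filter.Eventually.of_forall fun y => ?_
    refine measure_mono_null (t := {-y.2 / y.1}) ?_ (measure_singleton _)
    rintro x ⟨h1, h2⟩
    rw [Set.mem_singleton_iff, eq_div_iff h1]
    exact eq_neg_of_add_eq_zero_left h2
  rw [← hmap, Measure.map_apply (hY.prodMk hX) hZm] at hZ0
  have h' : ∀ᵐ ω ∂P, ω ∉ (fun ω => (Y ω, X ω)) ⁻¹' Z := measure_eq_zero_iff_ae_notMem.1 hZ0
  filter_upwards [h, h'] with ω h1 h2 h3
  exact h2 ⟨h1, h3⟩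

/-- A matrix with its upper left entry replaced by zero. -/
def eraseCorner {n : ℕ} (A : Matrix (Fin (n + 1)) (Fin (n + 1)) ℝ) :
    Matrix (Fin (n + 1)) (Fin (n + 1)) ℝ :=
  of fun i j => if i = 0 ∧ j = 0 then 0 else A i j

theorem eraseCorner_submatrix {n : ℕ} {m : Type*} (A : Matrix (Fin (n + 1)) (Fin (n + 1)) ℝ)
    (e : m → Fin (n + 1)) :
    (eraseCorner A).submatrix Fin.succ e = A.submatrix Fin.succ e := by
  ext i j
  simp [eraseCorner, Fin.succ_ne_zero]

/-- Laplace expansion along the first row: the determinant is affine in the corner entry, with a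
minor as slope. -/
theorem det_eq_corner_mul_add {n : ℕ} (A : Matrix (Fin (n + 1)) (Fin (n + 1)) ℝ) :
    A.det = A 0 0 * (A.submatrix Fin.succ Fin.succ).det + (eraseCorner A).det := by
  rw [det_succ_row_zero A, det_succ_row_zero (eraseCorner A), Fin.sum_univ_succ,
    Fin.sum_univ_succ]
  simp only [eraseCorner_submatrix]
  simp [eraseCorner, Fin.succ_ne_zero]

/-- Induction on the size: the slope in the corner entry is almost surely nonzero by the induction
hypothesis, and slope and intercept are functions of the other entries, hence independent of the
corner. -/
theorem ae_det_ne_zero (n : ℕ) {X : Fin n → Fin n → Ω → ℝ} (hX : ∀ i j, Measurable (X i j))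
    (hind : iIndepFun (fun p : Fin n × Fin n => X p.1 p.2) P)
    (hna : ∀ i j, NullSingletonClass (P.map (X i j))) :
    ∀ᵐ ω ∂P, (of fun i j => X i j ω).det ≠ 0 := by
  induction n with
  | zero => simp
  | succ n ih =>
    have hminor := ih (X := fun i j => X i.succ j.succ) (fun i j => hX _ _)
      (hind.precomp (g := fun p : Fin n × Fin n => (p.1.succ, p.2.succ))
        fun p q h => by
          simp only [Prod.mk.injEq, Fin.succ_inj] at h
          exact Prod.ext h.1 h.2) fun i j => hna _ _
    set T : Finset (Fin (n + 1) × Fin (n + 1)) := Finset.univ.erase (0, 0) with hT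
    set φ : (T → ℝ) → Matrix (Fin (n + 1)) (Fin (n + 1)) ℝ := fun y =>
      of fun i j => if h : (i, j) ∈ T then y ⟨(i, j), h⟩ else 0 with hφ
    have hφm : Measurable φ := by
      refine measurable_iff.2 fun i j => ?_
      by_cases h : (i, j) ∈ T
      · simpa [hφ, h] using measurable_pi_apply _
      · simp [hφ, h]
    have hφX : ∀ ω, φ (fun p => X p.1.1 p.1.2 ω) = eraseCorner (of fun i j => X i j ω) := by
      intro ω
      ext i j
      by_cases hi : i = 0 <;> by_cases hj : j = 0 <;> simp [hφ, hT, eraseCorner, hi, hj]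
    have hdet : Measurable fun A : Matrix (Fin (n + 1)) (Fin (n + 1)) ℝ =>
        ((A.submatrix Fin.succ Fin.succ).det, A.det) :=
      (Measurable.matrix_det (measurable_iff.2 fun i j =>
        measurable_id.matrix_apply i.succ j.succ)).prodMk measurable_id.matrix_det
    have hind' := hind.indepFun_finset T {(0, 0)} (by simp [hT]) fun p => hX _ _
    have hψm : Measurable fun y : (({(0, 0)} : Finset (Fin (n + 1) × Fin (n + 1))) → ℝ) =>
        y ⟨(0, 0), Finset.mem_singleton_self _⟩ := measurable_pi_apply _
    have hind2 := hind'.comp (hdet.comp hφm) hψm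
    simp only [Function.comp_def, hφX] at hind2
    have hXm : Measurable fun ω => of fun i j => X i j ω := measurable_iff.2 hX
    have hYm := hdet.comp (hφm.comp (measurable_pi_iff.2 fun p : T => hX p.1.1 p.1.2))
    simp only [Function.comp_def, hφX] at hYm
    have hna00 : NullSingletonClass (P.map (X 0 0)) := hna 0 0
    have key := ae_mul_add_ne_zero (hX 0 0) hYm hind2 (by
      filter_upwards [hminor] with ω hω
      rw [eraseCorner_submatrix]
      exact hω)
    filter_upwards [key] with ω hω
    rw [det_eq_corner_mul_add]
    rw [eraseCorner_submatrix] at hω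
    exact hω

/-- A kernel vector of UᵀU is a kernel vector of `U`, hence of its top k × k block, which is almost
surely invertible. -/
theorem ae_isUnit_det_transpose_mul {d k : ℕ} (hkd : k ≤ d) {X : Fin d → Fin k → Ω → ℝ}
    (hX : ∀ i j, Measurable (X i j))
    (hind : iIndepFun (fun p : Fin d × Fin k => X p.1 p.2) P)
    (hna : ∀ i j, NullSingletonClass (P.map (X i j))) :
    ∀ᵐ ω ∂P, IsUnit ((of fun i j => X i j ω)ᵀ * of fun i j => X i j ω).det := by
  have h := ae_det_ne_zero k (X := fun i j => X (Fin.castLE hkd i) j) (fun i j => hX _ _)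
    (hind.precomp (g := fun p : Fin k × Fin k => (Fin.castLE hkd p.1, p.2))
      fun p q h => by
        simp only [Prod.mk.injEq, Fin.castLE_inj] at h
        exact Prod.ext h.1 h.2) fun i j => hna _ _
  filter_upwards [h] with ω hω
  rw [isUnit_iff_ne_zero]
  contrapose! hω
  obtain ⟨v, hv, hv0⟩ := exists_mulVec_eq_zero_iff.2 hω
  refine exists_mulVec_eq_zero_iff.1 ⟨v, hv, ?_⟩
  have h1 : v ⬝ᵥ ((of fun i j => X i j ω)ᵀ * of fun i j => X i j ω) *ᵥ v = 0 := by
    rw [hv0, dotProduct_zero]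
  rw [dotProduct_transpose_mul_mulVec, dotProduct_self_eq_zero] at h1
  ext i
  exact congrFun h1 (Fin.castLE hkd i)

end FullRank

/-! ### The mean projection of a Gaussian matrix. -/

section GaussianProjection

variable {d k : ℕ}

/-- The standard Gaussian measure on `d × k` arrays. -/
noncomputable def stdGaussian (d k : ℕ) : Measure (Fin d × Fin k → ℝ) :=
  Measure.pi fun _ => gaussianReal 0 1

instance : IsProbabilityMeasure (stdGaussian d k) := by
  unfold stdGaussian
  infer_instance

/-- An array of entries as a matrix. -/
def ofEntries (y : Fin d × Fin k → ℝ) : Matrix (Fin d) (Fin k) ℝ := of fun i j => y (i, j)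

theorem measurable_ofEntries : Measurable (ofEntries : (Fin d × Fin k → ℝ) → _) :=
  measurable_iff.2 fun i j => measurable_pi_apply (i, j)

theorem ae_isUnit_det_stdGaussian (hkd : k ≤ d) :
    ∀ᵐ y ∂stdGaussian d k, IsUnit ((ofEntries y)ᵀ * ofEntries y).det := by
  refine ae_isUnit_det_transpose_mul hkd (P := stdGaussian d k)
    (X := fun i j (y : Fin d × Fin k → ℝ) => y (i, j)) (fun i j => measurable_pi_apply (i, j)) ?_ ?_
  · exact iIndepFun_pi (X := fun _ x => x) fun _ => aemeasurable_id
  · intro i j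
    have h := (measurePreserving_eval (fun _ : Fin d × Fin k => gaussianReal 0 1) (i, j)).map_eq
    have h' : (stdGaussian d k).map (fun y => y (i, j)) = gaussianReal 0 1 := h
    rw [h']
    exact nullSingletonClass_gaussianReal one_ne_zero

theorem measurePreserving_perm (σ : Equiv.Perm (Fin d)) :
    MeasurePreserving (fun (y : Fin d × Fin k → ℝ) p => y (σ p.1, p.2)) (stdGaussian d k)
      (stdGaussian d k) :=
  measurePreserving_arrowCongr' (fun _ : Fin d × Fin k => gaussianReal 0 1)
    (fun _ : Fin d × Fin k => gaussianReal 0 1) (σ.symm.prodCongr (Equiv.refl (Fin k)))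
    (MeasurableEquiv.refl ℝ) fun _ => MeasurePreserving.id _

theorem measurePreserving_sign {ε : Fin d → ℝ} (hε : ∀ i, ε i * ε i = 1) :
    MeasurePreserving (fun (y : Fin d × Fin k → ℝ) p => ε p.1 * y p) (stdGaussian d k)
      (stdGaussian d k) := by
  refine measurePreserving_pi _ _ (f := fun (p : Fin d × Fin k) x => ε p.1 * x) fun p =>
    ⟨measurable_const_mul _, ?_⟩
  rw [gaussianReal_map_const_mul, mul_zero]
  congr 1
  ext
  simp [sq, hε]

theorem measurable_rangeProj_ofEntries (i j : Fin d) :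
    Measurable fun y : Fin d × Fin k → ℝ => rangeProj (ofEntries y) i j :=
  (measurable_rangeProj.comp measurable_ofEntries).matrix_apply i j

theorem integrable_rangeProj (i j : Fin d) :
    Integrable (fun y => rangeProj (ofEntries y) i j) (stdGaussian d k) :=
  Integrable.of_bound (measurable_rangeProj_ofEntries i j).aestronglyMeasurable (k : ℝ)
    (Filter.Eventually.of_forall fun _ => abs_rangeProj_le _ i j)

/-- The expected projection onto the range of a Gaussian matrix is `(k / d) I`. -/
theorem integral_rangeProj (hkd : k ≤ d) (i j : Fin d) :
    ∫ y, rangeProj (ofEntries y) i j ∂stdGaussian d k = if i = j then (k : ℝ) / d else 0 := by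
  by_cases hij : i = j
  · subst hij
    rw [if_pos rfl]
    -- Swapping rows makes all diagonal means equal; their sum is the mean trace k.
    have hperm : ∀ a, ∫ y, rangeProj (ofEntries y) a a ∂stdGaussian d k =
        ∫ y, rangeProj (ofEntries y) i i ∂stdGaussian d k := by
      intro a
      have hmp := measurePreserving_perm (k := k) (Equiv.swap i a)
      conv_lhs => rw [← hmp.map_eq]
      rw [integral_map hmp.aemeasurable
        (measurable_rangeProj_ofEntries a a).aestronglyMeasurable]
      refine integral_congr_ae (Filter.Eventually.of_forall fun y => ?_)
      have := rangeProj_submatrix (ofEntries y) (Equiv.swap i a) a a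
      rw [Equiv.swap_apply_right] at this
      exact this
    have hsum : ∑ a, ∫ y, rangeProj (ofEntries y) a a ∂stdGaussian d k = k := by
      rw [← integral_finsetSum _ fun a _ => integrable_rangeProj a a]
      have : ∫ y, ∑ a, rangeProj (ofEntries y) a a ∂stdGaussian d k =
          ∫ _, (k : ℝ) ∂stdGaussian d k := by
        refine integral_congr_ae ?_
        filter_upwards [ae_isUnit_det_stdGaussian hkd] with y hy
        exact trace_rangeProj hy
      rw [this]
      simp
    simp only [hperm, Finset.sum_const, Finset.card_univ, Fintype.card_fin, nsmul_eq_mul] at hsum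
    have hd : (d : ℝ) ≠ 0 := by
      have := i.pos
      positivity
    rw [eq_div_iff hd, mul_comm]
    exact hsum
  · rw [if_neg hij]
    -- Flipping the sign of row `i` alone negates the entry (i, j), so its mean equals its own
    -- negative.
    set ε : Fin d → ℝ := fun a => if a = i then -1 else 1 with hε
    have hε1 : ∀ a, ε a * ε a = 1 := by
      intro a
      by_cases h : a = i <;> simp [hε, h]
    have hmp := measurePreserving_sign (k := k) hε1
    have h : ∫ y, rangeProj (ofEntries y) i j ∂stdGaussian d k =
        ∫ y, -rangeProj (ofEntries y) i j ∂stdGaussian d k := by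
      conv_lhs => rw [← hmp.map_eq]
      rw [integral_map hmp.aemeasurable
        (measurable_rangeProj_ofEntries i j).aestronglyMeasurable]
      refine integral_congr_ae (Filter.Eventually.of_forall fun y => ?_)
      have h1 := rangeProj_diagonal_mul (ofEntries y) hε1 i j
      have h2 : ofEntries (fun p : Fin d × Fin k => ε p.1 * y p) = diagonal ε * ofEntries y := by
        ext a b
        simp [ofEntries]
      simp only [h2, h1]
      simp [hε, Ne.symm hij]
    rw [integral_neg] at h
    linarith

end GaussianProjection

/-! ### Independence of the current direction from the past. -/

section Independence

variable {d k : ℕ} {Ω : Type*} [MeasurableSpace Ω] {P : Measure Ω} [IsProbabilityMeasure P]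
  {U : ℕ → Ω → Matrix (Fin d) (Fin k) ℝ}

theorem IsIIDGaussian.aemeasurable (hU : IsIIDGaussian P U) (t : ℕ) (i : Fin d) (j : Fin k) :
    AEMeasurable (fun ω => U t ω i j) P := (hU.1 t i j).aemeasurable

theorem IsIIDGaussian.aemeasurable_entries (hU : IsIIDGaussian P U) (t : ℕ) :
    AEMeasurable (fun ω (p : Fin d × Fin k) => U t ω p.1 p.2) P :=
  aemeasurable_pi_iff.2 fun p => hU.aemeasurable t p.1 p.2

theorem IsIIDGaussian.map_entries (hU : IsIIDGaussian P U) (t : ℕ) :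
    P.map (fun ω (p : Fin d × Fin k) => U t ω p.1 p.2) = stdGaussian d k := by
  have h := (iIndepFun_iff_map_fun_eq_pi_map (f := fun (p : Fin d × Fin k) ω => U t ω p.1 p.2)
    fun p => hU.aemeasurable t p.1 p.2).1
    (hU.2.precomp (g := fun p : Fin d × Fin k => (t, p.1, p.2)) fun p q h => by
      simp only [Prod.mk.injEq, true_and] at h
      exact Prod.ext h.1 h.2)
  rw [h, stdGaussian]
  congr 1
  ext1 p
  exact (hU.1 t p.1 p.2).map_eq

/-- The indices of the entries of the direction matrices used in the first `t` iterations. -/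
def pastIndices (d k t : ℕ) : Finset (ℕ × Fin d × Fin k) := Finset.range t ×ˢ Finset.univ

/-- The direction matrices with the given entries in the first `t` iterations, zero later. -/
noncomputable def extendPast {d k : ℕ} (t : ℕ) (y : pastIndices d k t → ℝ) (s : ℕ) :
    Matrix (Fin d) (Fin k) ℝ :=
  of fun i j => if h : (s, i, j) ∈ pastIndices d k t then y ⟨(s, i, j), h⟩ else 0

theorem measurable_extendPast (t s : ℕ) :
    Measurable fun y : pastIndices d k t → ℝ => extendPast t y s := by
  refine measurable_iff.2 fun i j => ?_
  by_cases h : (s, i, j) ∈ pastIndices d k t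
  · simpa [extendPast, h] using measurable_pi_apply _
  · simp [extendPast, h]

theorem run_extendPast (f : EuclideanSpace ℝ (Fin d) → ℝ) (M : ℝ) (s₀ : State d) (t : ℕ) (ω : Ω) :
    run f M s₀ (extendPast t fun p => U p.1.1 ω p.1.2.1 p.1.2.2) t =
      run f M s₀ (fun s => U s ω) t := by
  refine run_congr f M s₀ fun s hs => ?_
  ext i j
  simp [extendPast, pastIndices, hs]

/-- The state before an iteration is a measurable function of an almost everywhere measurable
history which is independent of the current direction matrix. -/
theorem IsIIDGaussian.indepFun_past (hU : IsIIDGaussian P U) (t : ℕ) :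
    IndepFun (fun ω (p : pastIndices d k t) => U p.1.1 ω p.1.2.1 p.1.2.2)
      (fun ω (p : Fin d × Fin k) => U t ω p.1 p.2) P := by
  have h := hU.2.indepFun_finset₀ (pastIndices d k t) (({t} : Finset ℕ) ×ˢ Finset.univ) (by
    rw [Finset.disjoint_left]
    intro p hp hp'
    simp only [pastIndices, Finset.mem_product, Finset.mem_range, Finset.mem_singleton] at hp hp'
    lia) fun p => hU.aemeasurable _ _ _
  exact h.comp (φ := id) (ψ := fun y (p : Fin d × Fin k) => y ⟨(t, p.1, p.2), by simp⟩)
    measurable_id (measurable_pi_iff.2 fun p => measurable_pi_apply _)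

theorem IsIIDGaussian.aemeasurable_past (hU : IsIIDGaussian P U) (t : ℕ) :
    AEMeasurable (fun ω (p : pastIndices d k t) => U p.1.1 ω p.1.2.1 p.1.2.2) P :=
  aemeasurable_pi_iff.2 fun _ => hU.aemeasurable _ _ _

variable {f : EuclideanSpace ℝ (Fin d) → ℝ}

theorem measurableState_extendPast (hf' : Differentiable ℝ (gradient f)) (M : ℝ) (s₀ : State d)
    (t : ℕ) : MeasurableState fun y : pastIndices d k t → ℝ => run f M s₀ (extendPast t y) t :=
  measurableState_run hf' M s₀ (fun s => measurable_extendPast t s) t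

theorem IsIIDGaussian.aemeasurable_state (hU : IsIIDGaussian P U) (M : ℝ) (s₀ : State d) (t : ℕ)
    {β : Type*} [MeasurableSpace β] {g : State d → β}
    (hg : Measurable fun y : pastIndices d k t → ℝ => g (run f M s₀ (extendPast t y) t)) :
    AEMeasurable (fun ω => g (run f M s₀ (fun s => U s ω) t)) P := by
  have := hg.comp_aemeasurable (hU.aemeasurable_past t)
  simpa only [Function.comp_def, run_extendPast] using this

/-- The expected pairing of two independent matrices, the second with scalar expectation. -/
theorem integral_trace_mul_of_indepFun {B Q : Ω → Matrix (Fin d) (Fin d) ℝ} {c : ℝ}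
    (hB : ∀ i j, Integrable (fun ω => B ω i j) P) (hQ : ∀ i j, Integrable (fun ω => Q ω i j) P)
    (hind : ∀ i j l m, IndepFun (fun ω => B ω i j) (fun ω => Q ω l m) P)
    (hc : ∀ i j, ∫ ω, Q ω i j ∂P = if i = j then c else 0) :
    Integrable (fun ω => (B ω * Q ω).trace) P ∧
      ∫ ω, (B ω * Q ω).trace ∂P = c * ∫ ω, (B ω).trace ∂P := by
  have hprod : ∀ i j, Integrable (fun ω => B ω i j * Q ω j i) P := fun i j =>
    (hind i j j i).integrable_mul (hB i j) (hQ j i)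
  simp only [trace, diag_apply, mul_apply]
  refine ⟨integrable_finsetSum _ fun i _ => integrable_finsetSum _ fun j _ => hprod i j, ?_⟩
  rw [integral_finsetSum _ fun i _ => integrable_finsetSum _ fun j _ => hprod i j,
    integral_finsetSum _ fun i _ => hB i i, Finset.mul_sum]
  refine Finset.sum_congr rfl fun i _ => ?_
  rw [integral_finsetSum _ fun j _ => hprod i j]
  have h1 : ∀ j, ∫ ω, B ω i j * Q ω j i ∂P =
      (∫ ω, B ω i j ∂P) * if j = i then c else 0 := by
    intro j
    rw [← hc j i]
    exact (hind i j j i).integral_mul_eq_mul_integral (hB i j).aestronglyMeasurable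
      (hQ j i).aestronglyMeasurable
  simp only [h1, mul_ite, mul_zero, Finset.sum_ite_eq', Finset.mem_univ, if_true]
  rw [mul_comm]

theorem IsIIDGaussian.integrable_rangeProj (hU : IsIIDGaussian P U) (t : ℕ) (i j : Fin d) :
    Integrable (fun ω => rangeProj (U t ω) i j) P :=
  Integrable.of_bound ((measurable_rangeProj_ofEntries i j).comp_aemeasurable
    (hU.aemeasurable_entries t)).aestronglyMeasurable (k : ℝ)
      (Filter.Eventually.of_forall fun _ => abs_rangeProj_le _ i j)

theorem IsIIDGaussian.integral_rangeProj (hU : IsIIDGaussian P U) (hkd : k ≤ d) (t : ℕ)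
    (i j : Fin d) : ∫ ω, rangeProj (U t ω) i j ∂P = if i = j then (k : ℝ) / d else 0 := by
  rw [← BlockBFGS.integral_rangeProj hkd, ← hU.map_entries t,
    integral_map (hU.aemeasurable_entries t)
      (measurable_rangeProj_ofEntries i j).aestronglyMeasurable]
  rfl

theorem IsIIDGaussian.ae_isUnit_det (hU : IsIIDGaussian P U) (hkd : k ≤ d) (t : ℕ) :
    ∀ᵐ ω ∂P, IsUnit ((U t ω)ᵀ * U t ω).det := by
  have h := ae_isUnit_det_stdGaussian hkd
  rw [← hU.map_entries t] at h
  exact ae_of_ae_map (hU.aemeasurable_entries t) h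

theorem IsIIDGaussian.indepFun_rangeProj (hU : IsIIDGaussian P U) (M : ℝ) (s₀ : State d) (t : ℕ)
    {g : State d → ℝ}
    (hg : Measurable fun y : pastIndices d k t → ℝ => g (run f M s₀ (extendPast t y) t))
    (i j : Fin d) :
    IndepFun (fun ω => g (run f M s₀ (fun s => U s ω) t)) (fun ω => rangeProj (U t ω) i j) P := by
  have := (hU.indepFun_past t).comp hg (measurable_rangeProj_ofEntries i j)
  simp only [Function.comp_def, run_extendPast] at this
  exact this

end Independence

end BlockBFGS

namespace BlockBFGS

open Matrix

/-! ### Scalar inequalities behind the contraction and the potential. -/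

section Scalar

theorem one_sub_one_div_one_add_le {σ : ℝ} (hσ : 0 ≤ σ) : 1 - 1 / (1 + σ) ≤ σ := by
  have h : 0 < 1 + σ := by linarith
  rw [sub_le_iff_le_add, ← sub_le_iff_le_add', le_div_iff₀ h]
  nlinarith

/-- With u = 1/η₀, the product is at most 1 - 8u/9 + u/40 + u/40, and 8/9 - 1/20 > 3/4. -/
theorem contraction_factor_le {η η₀ a : ℝ} (hη₀ : 1 ≤ η₀) (hη0 : 0 < η) (hη : η ≤ 9 / 8 * η₀)
    (ha0 : 0 ≤ a) (ha : a ≤ 1 / 20 / η₀) :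
    (1 + a / 2) * ((1 - 1 / η) + a / 2) ≤ 1 - 3 / (4 * η₀) := by
  have hη₀0 : 0 < η₀ := by linarith
  have hu : 1 / (9 / 8 * η₀) ≤ 1 / η := one_div_le_one_div_of_le hη0 hη
  set u := 1 / η₀ with hu'
  have hu0 : 0 < u := by positivity
  have e1 : 1 / (9 / 8 * η₀) = 8 / 9 * u := by rw [hu']; field_simp
  have e2 : 3 / (4 * η₀) = 3 / 4 * u := by rw [hu']; field_simp
  have e3 : 1 / 20 / η₀ = u / 20 := by rw [hu']; field_simp
  rw [e1] at hu
  rw [e3] at ha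
  rw [e2]
  have h1 : (1 - 1 / η) + a / 2 ≤ 1 - 8 / 9 * u + u / 40 := by linarith
  have h2 : (1 + a / 2) * ((1 - 1 / η) + a / 2) ≤ (1 + a / 2) * (1 - 8 / 9 * u + u / 40) :=
    mul_le_mul_of_nonneg_left h1 (by linarith)
  nlinarith [mul_nonneg ha0 hu0.le]

/-- The weight 2D matches the first-order drift q D · 2a caused by rescaling, and the smallest
admissible K for b = a makes the coefficients of σ on both sides equal. What remains is second order
in a and has the right sign. -/
theorem potential_step_le {q D σ a b K : ℝ} (hq : 0 < q) (hD1 : 1 ≤ D) (hσ : 0 ≤ σ) (ha : 0 ≤ a)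
    (hab : a ≤ b) (hK : 2 + b + 2 * D / q * (1 + b / 2) ≤ K) :
    q * ((1 + a) ^ 2 * (σ + D) - D) + 2 * D * (a * ((1 + a / 2) * (σ + a / 2))) ≤
      q * (1 + K * b) * (σ + 2 * D * a) := by
  have hD : 0 < D := by linarith
  have hφ : 0 ≤ σ + 2 * D * a := by positivity
  have hK' : 2 + a + 2 * D / q * (1 + a / 2) ≤ K := by
    refine le_trans ?_ hK
    have : 2 * D / q * (1 + a / 2) ≤ 2 * D / q * (1 + b / 2) :=
      mul_le_mul_of_nonneg_left (by linarith) (by positivity)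
    linarith
  have hK0 : 0 ≤ 2 + a + 2 * D / q * (1 + a / 2) := by positivity
  have h1 : (2 + a + 2 * D / q * (1 + a / 2)) * a ≤ K * b :=
    mul_le_mul hK' hab ha (hK0.trans hK')
  have h2 : q * (1 + (2 + a + 2 * D / q * (1 + a / 2)) * a) * (σ + 2 * D * a) ≤
      q * (1 + K * b) * (σ + 2 * D * a) :=
    mul_le_mul_of_nonneg_right (mul_le_mul_of_nonneg_left (by linarith) hq.le) hφ
  refine le_trans ?_ h2
  have e : q * (1 + (2 + a + 2 * D / q * (1 + a / 2)) * a) =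
      q + q * (2 * a + a ^ 2) + 2 * D * a * (1 + a / 2) := by
    field_simp
    ring
  rw [e]
  have p1 : 0 ≤ q * D * a ^ 2 * (3 + 2 * a) := by positivity
  have p2 : 0 ≤ (D - 1) * (D * a ^ 2 * (1 + a / 2)) :=
    mul_nonneg (by linarith) (by positivity)
  have p3 : 0 ≤ D * a ^ 2 * (1 + a / 2) := by positivity
  linarith

theorem sum_geometric_le {η₀ ε ρ : ℝ} (hη₀ : 0 < η₀) (hε : 0 ≤ ε) (hρ : ρ = 1 - 3 / (4 * η₀))
    (hρ0 : 0 ≤ ρ) (t : ℕ) : ∑ i ∈ Finset.range t, ε * ρ ^ i ≤ 4 / 3 * η₀ * ε := by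
  have h := geom_sum_mul_neg ρ t
  have h1 : 1 - ρ = 3 / (4 * η₀) := by rw [hρ]; ring
  have h2 : ∑ i ∈ Finset.range t, ρ ^ i ≤ 4 / 3 * η₀ := by
    rw [h1, ← eq_div_iff (by positivity)] at h
    rw [h, div_div_eq_mul_div, div_le_iff₀ three_pos]
    nlinarith [pow_nonneg hρ0 t]
  rw [← Finset.mul_sum, mul_comm]
  exact mul_le_mul_of_nonneg_right h2 hε

end Scalar

/-! ### Bounds valid along every trajectory. -/

section Trajectory

variable {d k : ℕ} {f : EuclideanSpace ℝ (Fin d) → ℝ} {M : ℝ}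

/-- Along every trajectory the scaled gradient norm decreases geometrically and the Hessian
estimator stays accurate up to a constant factor. -/
theorem invariant_run (hf' : Differentiable ℝ (gradient f)) (hM : StronglySelfConcordant M f)
    (hH : ∀ x, (hess f x).PosDef) {s₀ : State d} {η₀ ε ρ : ℝ} (h₀ : Invariant f η₀ s₀)
    (hρ : ρ = 1 - 3 / (4 * η₀)) (hε : ε ≤ 1 / 20 / η₀) (hlam : M * localGradNorm f s₀.x ≤ ε)
    (hexp : Real.exp (2 * (4 / 3 * η₀ * ε)) ≤ 9 / 8) (U : ℕ → Matrix (Fin d) (Fin k) ℝ) (t : ℕ) :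
    Invariant f (η₀ * Real.exp (2 * ∑ i ∈ Finset.range t, ε * ρ ^ i)) (run f M s₀ U t) ∧
      M * localGradNorm f (run f M s₀ U t).x ≤ ε * ρ ^ t := by
  have hη₀ := h₀.one_le
  have hη₀0 : 0 < η₀ := by linarith
  have hε0 : 0 ≤ ε := (mul_nonneg hM.1 (localGradNorm_nonneg _ _)).trans hlam
  have hsmall : 3 / (4 * η₀) ≤ 1 := by
    rw [div_le_one (by positivity)]
    linarith
  have hsmall0 : 0 < 3 / (4 * η₀) := by positivity
  have hρ0 : 0 ≤ ρ := by rw [hρ]; linarith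
  have hρ1 : ρ ≤ 1 := by rw [hρ]; linarith
  induction t with
  | zero => simpa [run] using ⟨h₀, hlam⟩
  | succ t ih =>
    obtain ⟨hinv, ha⟩ := ih
    set s := run f M s₀ U t with hs
    set a := M * localGradNorm f s.x with ha'
    have ha0 : 0 ≤ a := mul_nonneg hM.1 (localGradNorm_nonneg _ _)
    have hsum := sum_geometric_le hη₀0 hε0 hρ hρ0 t
    -- This closes the loop: the geometric decay so far keeps the growth of η below 9/8, which is
    -- what the contraction at rate ρ needs for the next step.
    have hη : η₀ * Real.exp (2 * ∑ i ∈ Finset.range t, ε * ρ ^ i) ≤ 9 / 8 * η₀ := by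
      rw [mul_comm]
      refine mul_le_mul_of_nonneg_right (le_trans (Real.exp_le_exp.2 ?_) hexp) hη₀0.le
      linarith
    have haε : a ≤ 1 / 20 / η₀ :=
      (ha.trans (mul_le_of_le_one_right hε0 (pow_le_one₀ hρ0 hρ1))).trans hε
    refine ⟨hinv.step hM hH (U t) ?_, ?_⟩
    · have h1 : 1 + a ≤ Real.exp (ε * ρ ^ t) :=
        (add_le_add_right ha 1).trans ((add_comm _ _).trans_le (Real.add_one_le_exp _))
      have h2 : (1 + a) ^ 2 ≤ Real.exp (ε * ρ ^ t) ^ 2 := pow_le_pow_left₀ (by linarith) h1 2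
      rw [Finset.sum_range_succ, mul_add, Real.exp_add, two_mul (ε * ρ ^ t), Real.exp_add,
        ← sq (Real.exp (ε * ρ ^ t))]
      calc (1 + a) ^ 2 * (η₀ * Real.exp (2 * ∑ i ∈ Finset.range t, ε * ρ ^ i))
          ≤ Real.exp (ε * ρ ^ t) ^ 2 * (η₀ * Real.exp (2 * ∑ i ∈ Finset.range t, ε * ρ ^ i)) :=
            mul_le_mul_of_nonneg_right h2 (by positivity)
        _ = _ := by ring
    · have h1 := hinv.localGradNorm_nextX_le hf' hM hH
      have h2 := contraction_factor_le hη₀ (by positivity) hη ha0 haε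
      rw [← hρ] at h2
      calc M * localGradNorm f (s.nextX f)
          ≤ M * ((1 + a / 2) * ((1 - 1 / _) + a / 2) * localGradNorm f s.x) :=
            mul_le_mul_of_nonneg_left h1 hM.1
        _ = (1 + a / 2) * ((1 - 1 / _) + a / 2) * a := by rw [ha']; ring
        _ ≤ ρ * a := mul_le_mul_of_nonneg_right h2 ha0
        _ ≤ ρ * (ε * ρ ^ t) := mul_le_mul_of_nonneg_left ha hρ0
        _ = ε * ρ ^ (t + 1) := by ring

/-- Takes η = 1 + σ in the contraction and uses 1 - 1/(1 + σ) ≤ σ. This links the convergence ratio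
to the expected trace error. -/
theorem Invariant.localGradNorm_nextX_le_sigma {η : ℝ} {s : State d} (h : Invariant f η s)
    (hf' : Differentiable ℝ (gradient f)) (hM : StronglySelfConcordant M f)
    (hH : ∀ x, (hess f x).PosDef) :
    localGradNorm f (s.nextX f) ≤ (1 + M * localGradNorm f s.x / 2) *
      (s.sigma f + M * localGradNorm f s.x / 2) * localGradNorm f s.x := by
  have hl := localGradNorm_nonneg f s.x
  have ha : 0 ≤ M * localGradNorm f s.x := mul_nonneg hM.1 hl
  refine ((h.of_sigma (hH _)).localGradNorm_nextX_le hf' hM hH).trans ?_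
  have := one_sub_one_div_one_add_le (h.sigma_nonneg (hH _))
  exact mul_le_mul_of_nonneg_right
    (mul_le_mul_of_nonneg_left (by linarith) (by linarith)) hl

end Trajectory

/-! ### Expected trace error and decrease of the potential. -/

section Expectation

variable {d k : ℕ} {f : EuclideanSpace ℝ (Fin d) → ℝ} {M : ℝ} {Ω : Type*} [MeasurableSpace Ω]
  {P : Measure Ω} [IsProbabilityMeasure P] {U : ℕ → Ω → Matrix (Fin d) (Fin k) ℝ}

/-- The expected accuracy of the Hessian estimator after an update. -/
theorem IsIIDGaussian.integral_sigma_succ (hU : IsIIDGaussian P U) (hkd : k ≤ d) (hd : 0 < d)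
    (hf' : Differentiable ℝ (gradient f)) (hM : StronglySelfConcordant M f)
    (hH : ∀ x, (hess f x).PosDef) {s₀ : State d} {η : ℝ} {t : ℕ}
    (hinv : ∀ ω, Invariant f η (run f M s₀ (fun s => U s ω) t))
    {C : ℝ} (hC : ∀ ω, ((run f M s₀ (fun s => U s ω) t).gain f M).trace ≤ C) :
    Integrable (fun ω => ((run f M s₀ (fun s => U s ω) t).gain f M).trace) P ∧
    ∫ ω, (run f M s₀ (fun s => U s ω) (t + 1)).sigma f ∂P =
      (1 - (k : ℝ) / d) * ∫ ω, (((run f M s₀ (fun s => U s ω) t).gain f M).trace - d) ∂P := by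
  have hms := measurableState_extendPast (k := k) hf' M s₀ t
  have hgm := hms.gain hf' M
  set B : Ω → Matrix (Fin d) (Fin d) ℝ := fun ω => (run f M s₀ (fun s => U s ω) t).gain f M with hB
  have hBm : ∀ i j, AEMeasurable (fun ω => B ω i j) P := fun i j =>
    hU.aemeasurable_state (g := fun s => s.gain f M i j) M s₀ t (hgm.matrix_apply i j)
  have hBi : ∀ i j, Integrable (fun ω => B ω i j) P := fun i j =>
    Integrable.of_bound (hBm i j).aestronglyMeasurable C (Filter.Eventually.of_forall fun ω =>
      ((gain_posSemidef hH).abs_apply_le_trace i j).trans (hC ω))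
  have htr : Integrable (fun ω => (B ω).trace) P := integrable_finsetSum _ fun i _ => hBi i i
  -- `B` is a function of the past and the projection of the current direction, so the mean of tr(B
  -- Π) is k/d times the mean of tr B.
  obtain ⟨h1, h2⟩ := integral_trace_mul_of_indepFun (Q := fun ω => rangeProj (U t ω)) hBi
    (hU.integrable_rangeProj t)
    (fun i j => hU.indepFun_rangeProj M s₀ t (g := fun s => s.gain f M i j) (hgm.matrix_apply i j))
    (hU.integral_rangeProj hkd t)
  refine ⟨htr, ?_⟩
  -- Only almost everywhere: the exact trace formula needs a direction of full rank.
  have hae : (fun ω => (run f M s₀ (fun s => U s ω) (t + 1)).sigma f) =ᵐ[P] fun ω =>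
      ((B ω).trace - (B ω * rangeProj (U t ω)).trace) + ((k : ℝ) - d) := by
    filter_upwards [hU.ae_isUnit_det hkd t] with ω hω
    rw [run, (hinv ω).sigma_step hM hH hω]
    rw [rangeProj]
    ring
  have hsub : Integrable (fun ω => (B ω).trace - (B ω * rangeProj (U t ω)).trace) P := htr.sub h1
  have hlast : ∫ ω, ((B ω).trace - (d : ℝ)) ∂P = ∫ ω, (B ω).trace ∂P - d := by
    rw [integral_sub htr (integrable_const _), integral_const, probReal_univ, one_smul]
  change _ = (1 - (k : ℝ) / d) * ∫ ω, ((B ω).trace - (d : ℝ)) ∂P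
  rw [integral_congr_ae hae, integral_add hsub (integrable_const _), integral_sub htr h1, h2, hlast]
  simp only [integral_const, probReal_univ, one_smul]
  have : (d : ℝ) ≠ 0 := by positivity
  field_simp
  ring

theorem IsIIDGaussian.aestronglyMeasurable_sigma (hU : IsIIDGaussian P U)
    (hf' : Differentiable ℝ (gradient f)) (M : ℝ) (s₀ : State d) (t : ℕ) :
    AEStronglyMeasurable (fun ω => (run f M s₀ (fun s => U s ω) t).sigma f) P :=
  (hU.aemeasurable_state M s₀ t
    ((measurableState_extendPast hf' M s₀ t).sigma f)).aestronglyMeasurable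

theorem IsIIDGaussian.aemeasurable_localGradNorm (hU : IsIIDGaussian P U)
    (hf' : Differentiable ℝ (gradient f)) (M : ℝ) (s₀ : State d) (t : ℕ) :
    AEMeasurable (fun ω => localGradNorm f (run f M s₀ (fun s => U s ω) t).x) P :=
  hU.aemeasurable_state (g := fun s => localGradNorm f s.x) M s₀ t
    ((measurable_localGradNorm hf').comp (measurableState_extendPast hf' M s₀ t).x)

theorem IsIIDGaussian.integrable_sigma (hU : IsIIDGaussian P U)
    (hf' : Differentiable ℝ (gradient f)) (hH : ∀ x, (hess f x).PosDef) {s₀ : State d} {η : ℝ}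
    {t : ℕ} (hinv : ∀ ω, Invariant f η (run f M s₀ (fun s => U s ω) t)) :
    Integrable (fun ω => (run f M s₀ (fun s => U s ω) t).sigma f) P := by
  refine Integrable.of_bound (hU.aestronglyMeasurable_sigma hf' M s₀ t) (d * (η - 1))
    (Filter.Eventually.of_forall fun ω => ?_)
  rw [Real.norm_of_nonneg ((hinv ω).sigma_nonneg (hH _))]
  exact (hinv ω).sigma_le (hH _)

theorem IsIIDGaussian.integrable_mul_localGradNorm (hU : IsIIDGaussian P U)
    (hf' : Differentiable ℝ (gradient f)) (hM : 0 ≤ M) {s₀ : State d} {b : ℝ} {t : ℕ}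
    (hb : ∀ ω, M * localGradNorm f (run f M s₀ (fun s => U s ω) t).x ≤ b) :
    Integrable (fun ω => M * localGradNorm f (run f M s₀ (fun s => U s ω) t).x) P := by
  refine Integrable.of_bound
    ((hU.aemeasurable_localGradNorm hf' M s₀ t).const_mul M).aestronglyMeasurable b
    (Filter.Eventually.of_forall fun ω => ?_)
  rw [Real.norm_of_nonneg (mul_nonneg hM (localGradNorm_nonneg _ _))]
  exact hb ω

/-- The potential `sigma + 2 d M λ` decreases in expectation, up to a factor close to one, at the
rate `1 - k / d`. -/
theorem IsIIDGaussian.integral_potential_succ_le (hU : IsIIDGaussian P U) (hkd : k < d)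
    (hf' : Differentiable ℝ (gradient f)) (hM : StronglySelfConcordant M f)
    (hH : ∀ x, (hess f x).PosDef) {s₀ : State d} {η η' b b' K : ℝ} {t : ℕ}
    (hinv : ∀ ω, Invariant f η (run f M s₀ (fun s => U s ω) t))
    (hinv' : ∀ ω, Invariant f η' (run f M s₀ (fun s => U s ω) (t + 1)))
    (hb : ∀ ω, M * localGradNorm f (run f M s₀ (fun s => U s ω) t).x ≤ b)
    (hb' : ∀ ω, M * localGradNorm f (run f M s₀ (fun s => U s ω) (t + 1)).x ≤ b')
    (hK : 2 + b + 2 * (d : ℝ) / (1 - (k : ℝ) / d) * (1 + b / 2) ≤ K) :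
    ∫ ω, ((run f M s₀ (fun s => U s ω) (t + 1)).sigma f +
        2 * d * (M * localGradNorm f (run f M s₀ (fun s => U s ω) (t + 1)).x)) ∂P ≤
      (1 - (k : ℝ) / d) * (1 + K * b) *
        ∫ ω, ((run f M s₀ (fun s => U s ω) t).sigma f +
          2 * d * (M * localGradNorm f (run f M s₀ (fun s => U s ω) t).x)) ∂P := by
  have hd : (1 : ℝ) ≤ d := by
    have : 1 ≤ d := by lia
    exact_mod_cast this
  have hq : 0 < 1 - (k : ℝ) / d := by
    rw [sub_pos, div_lt_one (by linarith)]
    exact_mod_cast hkd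
  set q := 1 - (k : ℝ) / d with hqdef
  set S : Ω → State d := fun ω => run f M s₀ (fun s => U s ω) t with hS
  set S' : Ω → State d := fun ω => run f M s₀ (fun s => U s ω) (t + 1) with hS'
  have ha : ∀ ω, 0 ≤ M * localGradNorm f (S ω).x := fun ω =>
    mul_nonneg hM.1 (localGradNorm_nonneg _ _)
  have hσi := hU.integrable_sigma hf' hH hinv
  have hσi' := hU.integrable_sigma hf' hH hinv'
  have hai := hU.integrable_mul_localGradNorm hf' hM.1 hb
  have hai' := hU.integrable_mul_localGradNorm hf' hM.1 hb'
  have hgain : ∀ ω, ((S ω).gain f M).trace ≤ (1 + b) ^ 2 * (d * (η - 1) + d) := fun ω => by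
    refine ((hinv ω).trace_gain_le hM hH).trans ?_
    have h1 := (hinv ω).sigma_le (hH _)
    have h2 := (hinv ω).sigma_nonneg (hH _)
    have h3 := ha ω
    exact mul_le_mul (pow_le_pow_left₀ (by linarith) (add_le_add_right (hb ω) 1) 2)
      (add_le_add_left h1 _) (by linarith) (sq_nonneg _)
  obtain ⟨htr, hsig⟩ := hU.integral_sigma_succ hkd.le (by lia) hf' hM hH hinv hgain
  have hφi : Integrable (fun ω => q * (1 + K * b) *
      ((S ω).sigma f + 2 * d * (M * localGradNorm f (S ω).x))) P :=
    (hσi.add (hai.const_mul _)).const_mul _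
  have hi1 : Integrable (fun ω => q * (((S ω).gain f M).trace - d)) P :=
    (htr.sub (integrable_const _)).const_mul q
  have hi2 : Integrable (fun ω => 2 * d * (M * localGradNorm f (S' ω).x)) P := hai'.const_mul _
  have hi3 : Integrable (fun ω => q * (((S ω).gain f M).trace - d) +
      2 * d * (M * localGradNorm f (S' ω).x)) P := hi1.add hi2
  calc ∫ ω, ((S' ω).sigma f + 2 * d * (M * localGradNorm f (S' ω).x)) ∂P
      = ∫ ω, (q * (((S ω).gain f M).trace - d) + 2 * d * (M * localGradNorm f (S' ω).x)) ∂P := by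
        rw [integral_add hσi' hi2, hsig, integral_add hi1 hi2, integral_const_mul q]
    _ ≤ ∫ ω, q * (1 + K * b) * ((S ω).sigma f + 2 * d * (M * localGradNorm f (S ω).x)) ∂P := by
        refine integral_mono hi3 hφi fun ω => ?_
        have h1 := (hinv ω).trace_gain_le hM hH
        have h2 := (hinv ω).localGradNorm_nextX_le_sigma hf' hM hH
        have h3 := potential_step_le hq hd ((hinv ω).sigma_nonneg (hH _)) (ha ω) (hb ω) hK
        refine le_trans (add_le_add ?_ ?_) h3
        · exact mul_le_mul_of_nonneg_left (sub_le_sub_right h1 _) hq.le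
        · refine mul_le_mul_of_nonneg_left ?_ (by positivity)
          refine (mul_le_mul_of_nonneg_left h2 hM.1).trans (le_of_eq ?_)
          ring
    _ = _ := integral_const_mul _ _

end Expectation

end BlockBFGS

/-! ### Numerical constants and the final bound. -/

namespace BlockBFGS

open Matrix

/-- Numerical bounds for the initial radius. -/
theorem initial_radius_bounds {D q η₀ ε : ℝ} (hD : 2 ≤ D) (hq : 0 < q) (hq1 : q ≤ 1 - 1 / D)
    (hη₀ : 1 ≤ η₀) (hε : ε = Real.log 2 / 4 * (q / (η₀ * D))) :
    0 ≤ ε ∧ ε ≤ 1 / 20 / η₀ ∧ Real.exp (2 * (4 / 3 * η₀ * ε)) ≤ 9 / 8 ∧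
      (1 + ε / 2) * Real.exp ((2 + ε + 2 * D / q * (1 + ε / 2)) * (4 / 3 * η₀ * ε)) ≤ 2 := by
  have hD0 : 0 < D := by linarith
  have hη0 : 0 < η₀ := by linarith
  have hl0 := Real.log_two_gt_d9
  have hl1 := Real.log_two_lt_d9
  set l := Real.log 2 with hl
  -- (1 - 1/D)/D is largest at D = 2.
  have hp : q / D ≤ 1 / 4 := by
    rw [div_le_iff₀ hD0]
    have : 1 - 1 / D ≤ 1 / 4 * D := by
      rw [sub_le_iff_le_add, ← sub_le_iff_le_add', le_div_iff₀ hD0]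
      nlinarith [sq_nonneg (D - 2)]
    linarith
  have hp0 : 0 < q / D := div_pos hq hD0
  set p := q / D with hpdef
  have hεp : ε = l / 4 * p / η₀ := by
    rw [hε, hpdef]
    field_simp
  have hηε : η₀ * ε = l / 4 * p := by
    rw [hεp]
    field_simp
  have hε0 : 0 ≤ ε := by
    rw [hεp]
    positivity
  have hεle : ε ≤ 1 / 20 / η₀ := by
    rw [hεp]
    refine div_le_div_of_nonneg_right ?_ hη0.le
    nlinarith
  have hε20 : ε ≤ 1 / 20 := hεle.trans (div_le_self (by norm_num) hη₀)
  refine ⟨hε0, hεle, ?_, ?_⟩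
  · rw [← Real.le_log_iff_exp_le (by norm_num)]
    -- That is, 2 ≤ (9/8)⁶. The exponent is (2/3) l p ≤ l/6 because p ≤ 1/4.
    have h1 : l ≤ 6 * Real.log (9 / 8) := by
      rw [hl, ← Real.log_rpow (by norm_num)]
      exact Real.log_le_log (by norm_num) (by norm_num)
    have h2 : 2 * (4 / 3 * η₀ * ε) = 2 / 3 * (l * p) := by
      rw [mul_assoc (4 / 3), hηε]
      ring
    rw [h2]
    nlinarith
  · have h1 : (2 + ε + 2 * D / q * (1 + ε / 2)) * (4 / 3 * η₀ * ε) =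
        l / 3 * (p * (2 + ε) + 2 * (1 + ε / 2)) := by
      rw [mul_assoc (4 / 3), hηε, hpdef]
      field_simp
    -- The reserve 1/40 pays for the prefactor 1 + ε/2, since ε ≤ 1/20.
    have h2 : (2 + ε + 2 * D / q * (1 + ε / 2)) * (4 / 3 * η₀ * ε) ≤ l - 1 / 40 := by
      rw [h1]
      have : p * (2 + ε) ≤ 1 / 4 * (2 + 1 / 20) :=
        mul_le_mul hp (by linarith) (by linarith) (by norm_num)
      nlinarith
    have h3 : 1 + ε / 2 ≤ Real.exp (1 / 40) :=
      le_trans (by linarith) (Real.add_one_le_exp (1 / 40))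
    calc _ ≤ Real.exp (1 / 40) * Real.exp (l - 1 / 40) :=
          mul_le_mul h3 (Real.exp_le_exp.2 h2) (Real.exp_pos _).le (Real.exp_pos _).le
      _ = 2 := by
        rw [← Real.exp_add, add_sub_cancel, hl, Real.exp_log two_pos]

variable {d k : ℕ} {f : EuclideanSpace ℝ (Fin d) → ℝ} {M : ℝ} {Ω : Type*} [MeasurableSpace Ω]
  {P : Measure Ω} [IsProbabilityMeasure P] {U : ℕ → Ω → Matrix (Fin d) (Fin k) ℝ}

/-- Iterates the one-step decrease, with 1 + K b ≤ exp(K b) turning the product into an exponential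
of a sum. -/
theorem IsIIDGaussian.integral_potential_le (hU : IsIIDGaussian P U) (hkd : k < d)
    (hf' : Differentiable ℝ (gradient f)) (hM : StronglySelfConcordant M f)
    (hH : ∀ x, (hess f x).PosDef) {s₀ : State d} {K : ℝ} {η b : ℕ → ℝ}
    (hinv : ∀ t ω, Invariant f (η t) (run f M s₀ (fun s => U s ω) t))
    (hb : ∀ t ω, M * localGradNorm f (run f M s₀ (fun s => U s ω) t).x ≤ b t)
    (hK : ∀ t, 2 + b t + 2 * (d : ℝ) / (1 - (k : ℝ) / d) * (1 + b t / 2) ≤ K) (t : ℕ) :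
    ∫ ω, ((run f M s₀ (fun s => U s ω) t).sigma f +
        2 * d * (M * localGradNorm f (run f M s₀ (fun s => U s ω) t).x)) ∂P ≤
      (1 - (k : ℝ) / d) ^ t * Real.exp (K * ∑ i ∈ Finset.range t, b i) *
        (s₀.sigma f + 2 * d * (M * localGradNorm f s₀.x)) := by
  have hq : 0 ≤ 1 - (k : ℝ) / d :=
    sub_nonneg.2 (div_le_one_of_le₀ (by exact_mod_cast hkd.le) (Nat.cast_nonneg d))
  induction t with
  | zero => simp [run]
  | succ t ih =>
    refine (hU.integral_potential_succ_le hkd hf' hM hH (hinv t) (hinv (t + 1)) (hb t)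
      (hb (t + 1)) (hK t)).trans ?_
    have hnn : 0 ≤ ∫ ω, ((run f M s₀ (fun s => U s ω) t).sigma f +
        2 * d * (M * localGradNorm f (run f M s₀ (fun s => U s ω) t).x)) ∂P :=
      integral_nonneg fun ω => add_nonneg ((hinv t ω).sigma_nonneg (hH _))
        (mul_nonneg (by positivity) (mul_nonneg hM.1 (localGradNorm_nonneg _ _)))
    have hexp : 1 + K * b t ≤ Real.exp (K * b t) := by
      rw [add_comm]
      exact Real.add_one_le_exp _
    calc _ ≤ (1 - (k : ℝ) / d) * Real.exp (K * b t) *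
          ((1 - (k : ℝ) / d) ^ t * Real.exp (K * ∑ i ∈ Finset.range t, b i) *
            (s₀.sigma f + 2 * d * (M * localGradNorm f s₀.x))) :=
          mul_le_mul (mul_le_mul_of_nonneg_left hexp hq) ih hnn (by positivity)
      _ = _ := by
        rw [Finset.sum_range_succ, mul_add K, Real.exp_add, pow_succ]
        ring

end BlockBFGS

theorem theorem5p8 {d k : ℕ} (hk : 1 ≤ k) (hkd : k < d)
    (f : EuclideanSpace ℝ (Fin d) → ℝ)
    (hf : Differentiable ℝ f) (hf' : Differentiable ℝ (gradient f))
    (Lsm : ℝ≥0) (hsmooth : LipschitzWith Lsm (gradient f))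
    (μ : ℝ) (hμ : 0 < μ) (hconv : StrongConvexOn Set.univ μ f)
    (M : ℝ) (hM : BlockBFGS.StronglySelfConcordant M f)
    (x₀ : EuclideanSpace ℝ (Fin d)) (G₀ L₀ : Matrix (Fin d) (Fin d) ℝ)
    (η₀ : ℝ) (hη₀ : 1 ≤ η₀)
    (hx₀ : M * BlockBFGS.localGradNorm f x₀ ≤
      Real.log 2 / 4 * (((d : ℝ) - k) / (η₀ * (d : ℝ) ^ 2)))
    (hG₀ : BlockBFGS.hess f x₀ ≤ G₀) (hG₀' : G₀ ≤ η₀ • BlockBFGS.hess f x₀)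
    (hL₀ : G₀⁻¹ = L₀ᵀ * L₀)
    {Ω : Type*} [MeasurableSpace Ω] (P : Measure Ω) [IsProbabilityMeasure P]
    (U : ℕ → Ω → Matrix (Fin d) (Fin k) ℝ) (hU : BlockBFGS.IsIIDGaussian P U)
    (x : ℕ → Ω → EuclideanSpace ℝ (Fin d))
    (hx : ∀ t ω, x t ω = (BlockBFGS.run f M ⟨x₀, G₀, L₀⟩ (fun s => U s ω) t).x) (t : ℕ) :
    Integrable (fun ω => BlockBFGS.localGradNorm f (x (t + 1) ω) /
        BlockBFGS.localGradNorm f (x t ω)) P ∧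
      ∫ ω, BlockBFGS.localGradNorm f (x (t + 1) ω) / BlockBFGS.localGradNorm f (x t ω) ∂P ≤
        2 * (d : ℝ) * η₀ * (1 - (k : ℝ) / d) ^ t := by
  have hH : ∀ x, (BlockBFGS.hess f x).PosDef := BlockBFGS.hess_posDef hf hf' hμ hconv
  have hD : (2 : ℝ) ≤ d := by
    have : 2 ≤ d := by lia
    exact_mod_cast this
  have hD0 : (0 : ℝ) < d := by linarith
  have hη₀0 : 0 < η₀ := by linarith
  have hk1 : (1 : ℝ) ≤ k := by exact_mod_cast hk
  have hkd' : (k : ℝ) < d := by exact_mod_cast hkd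
  set q : ℝ := 1 - (k : ℝ) / d with hqdef
  have hq : 0 < q := sub_pos.2 ((div_lt_one hD0).2 hkd')
  have hq1 : q ≤ 1 - 1 / d := sub_le_sub_left (div_le_div_of_nonneg_right hk1 hD0.le) 1
  obtain ⟨ε, hεdef⟩ : ∃ ε : ℝ, ε = Real.log 2 / 4 * (q / (η₀ * d)) := ⟨_, rfl⟩
  obtain ⟨hε0, hε, hexp, hfin⟩ := BlockBFGS.initial_radius_bounds hD hq hq1 hη₀ hεdef
  have hε20 : ε ≤ 1 / 20 := hε.trans (div_le_self (by norm_num) hη₀)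
  have hlam : M * BlockBFGS.localGradNorm f x₀ ≤ ε := by
    refine hx₀.trans (le_of_eq ?_)
    rw [hεdef, hqdef]
    field_simp
  set s₀ : BlockBFGS.State d := ⟨x₀, G₀, L₀⟩ with hs₀
  have h₀ : BlockBFGS.Invariant f η₀ s₀ := ⟨hη₀, hG₀, hG₀', hL₀⟩
  obtain ⟨ρ, hρ⟩ : ∃ ρ : ℝ, ρ = 1 - 3 / (4 * η₀) := ⟨_, rfl⟩
  have hsmall : 3 / (4 * η₀) ≤ 1 := by
    rw [div_le_one (by positivity)]
    linarith
  have hρ0 : 0 ≤ ρ := by linarith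
  have hρ1 : ρ ≤ 1 := by
    have : 0 < 3 / (4 * η₀) := by positivity
    linarith
  have hrun := fun t ω => BlockBFGS.invariant_run hf' hM hH h₀ hρ hε hlam hexp
    (fun s => U s ω) t
  have hbε : ∀ t, ε * ρ ^ t ≤ ε := fun t => mul_le_of_le_one_right hε0 (pow_le_one₀ hρ0 hρ1)
  have hpot := hU.integral_potential_le hkd hf' hM hH (K := 2 + ε + 2 * (d : ℝ) / q * (1 + ε / 2))
    (fun t ω => (hrun t ω).1) (fun t ω => (hrun t ω).2) (fun t => by
      have := hbε t
      have h1 : 2 * (d : ℝ) / q * (1 + ε * ρ ^ t / 2) ≤ 2 * (d : ℝ) / q * (1 + ε / 2) :=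
        mul_le_mul_of_nonneg_left (by linarith) (by positivity)
      linarith) t
  have hinv := fun ω => (hrun t ω).1
  have hb : ∀ ω, M * BlockBFGS.localGradNorm f
      (BlockBFGS.run f M s₀ (fun s => U s ω) t).x ≤ ε := fun ω => (hrun t ω).2.trans (hbε t)
  have hφi := (hU.integrable_sigma hf' hH hinv).add
    ((hU.integrable_mul_localGradNorm hf' hM.1 hb).const_mul (2 * (d : ℝ)))
  have hratio0 : ∀ ω, 0 ≤ BlockBFGS.localGradNorm f (x (t + 1) ω) /
      BlockBFGS.localGradNorm f (x t ω) := fun ω =>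
    div_nonneg (BlockBFGS.localGradNorm_nonneg _ _) (BlockBFGS.localGradNorm_nonneg _ _)
  have hratio : ∀ ω, BlockBFGS.localGradNorm f (x (t + 1) ω) /
      BlockBFGS.localGradNorm f (x t ω) ≤
      (1 + ε / 2) * ((BlockBFGS.run f M s₀ (fun s => U s ω) t).sigma f +
        2 * d * (M * BlockBFGS.localGradNorm f (BlockBFGS.run f M s₀ (fun s => U s ω) t).x)) := by
    intro ω
    rw [hx, hx]
    have h1 := (hinv ω).localGradNorm_nextX_le_sigma hf' hM hH
    have h2 := hb ω
    have h3 := (hinv ω).sigma_nonneg (hH _)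
    have h4 := BlockBFGS.localGradNorm_nonneg f (BlockBFGS.run f M s₀ (fun s => U s ω) t).x
    have h5 := mul_nonneg hM.1 h4
    -- This form of the division bound also covers a vanishing denominator, where the quotient is 0
    -- by convention.
    refine div_le_of_le_mul₀ h4 (mul_nonneg (by linarith) (add_nonneg h3
      (mul_nonneg (by linarith) h5))) (h1.trans (mul_le_mul_of_nonneg_right ?_ h4))
    exact mul_le_mul (by linarith) (by nlinarith) (by linarith) (by linarith)
  have hmeas : AEStronglyMeasurable (fun ω => BlockBFGS.localGradNorm f (x (t + 1) ω) /
      BlockBFGS.localGradNorm f (x t ω)) P := by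
    simp only [hx]
    exact ((hU.aemeasurable_localGradNorm hf' M s₀ (t + 1)).div
      (hU.aemeasurable_localGradNorm hf' M s₀ t)).aestronglyMeasurable
  have hint : Integrable (fun ω => BlockBFGS.localGradNorm f (x (t + 1) ω) /
      BlockBFGS.localGradNorm f (x t ω)) P := by
    refine (hφi.const_mul (1 + ε / 2)).mono' hmeas (Filter.Eventually.of_forall fun ω => ?_)
    rw [Real.norm_of_nonneg (hratio0 ω)]
    exact hratio ω
  refine ⟨hint, (integral_mono hint (hφi.const_mul (1 + ε / 2)) hratio).trans ?_⟩
  rw [integral_const_mul]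
  -- σ at the start is at most d (η₀ - 1), and the second term is at most d/10, which fits in the
  -- remaining d.
  have hstart : s₀.sigma f + 2 * d * (M * BlockBFGS.localGradNorm f s₀.x) ≤ d * η₀ := by
    have h1 := h₀.sigma_le (hH _)
    have h2 : M * BlockBFGS.localGradNorm f s₀.x ≤ 1 / 20 := hlam.trans hε20
    nlinarith
  have hgrow : Real.exp ((2 + ε + 2 * (d : ℝ) / q * (1 + ε / 2)) *
      ∑ i ∈ Finset.range t, ε * ρ ^ i) ≤
      Real.exp ((2 + ε + 2 * (d : ℝ) / q * (1 + ε / 2)) * (4 / 3 * η₀ * ε)) :=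
    Real.exp_le_exp.2 (mul_le_mul_of_nonneg_left
      (BlockBFGS.sum_geometric_le hη₀0 hε0 hρ hρ0 t) (by positivity))
  set E := Real.exp ((2 + ε + 2 * (d : ℝ) / q * (1 + ε / 2)) * (4 / 3 * η₀ * ε)) with hE
  have hqt : 0 ≤ q ^ t := pow_nonneg hq.le t
  have hstep : q ^ t * Real.exp ((2 + ε + 2 * (d : ℝ) / q * (1 + ε / 2)) *
      ∑ i ∈ Finset.range t, ε * ρ ^ i) *
      (s₀.sigma f + 2 * d * (M * BlockBFGS.localGradNorm f s₀.x)) ≤ q ^ t * E * (d * η₀) :=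
    mul_le_mul (mul_le_mul_of_nonneg_left hgrow hqt) hstart
      (add_nonneg (h₀.sigma_nonneg (hH _)) (mul_nonneg (by positivity)
        (mul_nonneg hM.1 (BlockBFGS.localGradNorm_nonneg _ _))))
      (mul_nonneg hqt (Real.exp_pos _).le)
  calc _ ≤ (1 + ε / 2) * (q ^ t * E * (d * η₀)) :=
        mul_le_mul_of_nonneg_left (hpot.trans hstep) (by linarith)
    _ = ((1 + ε / 2) * E) * (d * η₀ * q ^ t) := by ring
    _ ≤ 2 * (d * η₀ * q ^ t) := mul_le_mul_of_nonneg_right hfin (by positivity)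
    _ = 2 * d * η₀ * q ^ t := by ring
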